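/- An arithmetic matroid $\mathcal A=(E,\mathrm{rk},m)$ consists of a matroid $(E,\mathrm{rk})$ on a finite set $E$ and a multiplicity function $m:2^E\to\mathbb Z_{\ge 1}$ satisfying the axioms (P), (A1), (A2) of D'Adderio–Moci and Brändén–Moci. For an integer $k\ge 0$ put $\mathcal A^k=(E,\mathrm{rk},m^k)$, which is again an arithmetic matroid. A list $X=(x_e)_{e\in E}$ of elements of a finitely generated abelian group $G$, with torsion subgroup $G_t$, represents $\mathcal A$ if its image in the lattice $G/G_t$ represents the matroid $(E,\mathrm{rk})$ and $m(S)=|G_S/\langle S\rangle|$ for all $S\subseteq E$, where $\langle S\rangle$ is the subgroup generated by $\{x_e:e\in S\}$ and $G_S$ is the maximal subgroup of $G$ in which $\langle S\rangle$ has finite index; $\mathcal A$ is representable if such an $X$ exists. $\mathcal A$ is torsion-free if $m(\emptyset)=1$. A matroid is regular if it is representable over every field. $\mathcal A$ is called regular and weakly multiplicative if there are a finite set $Y$ disjoint from $E$ and a torsion-free arithmetic matroid $\mathcal A'=(E\cup Y,\mathrm{rk}',m')$ with $\mathcal A=\mathcal A'/Y$ (that is, $\mathrm{rk}(S)=\mathrm{rk}'(S\cup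 Y)-\mathrm{rk}'(Y)$ and $m(S)=m'(S\cup Y)$ for all $S\subseteq E$) such that $\mathcal A'$ is representable, its underlying matroid is regular, and $\mathcal A'$ has a basis $B\supseteq Y$ with $m'(B)=\prod_{x\in B}m'(\{x\})$. **Theorem.** Let $\mathcal A$ be an arithmetic matroid on $E$ that is regular and weakly multiplicative. Then $\mathcal A^k$ is representable for every integer $k\ge 0$. More precisely, there are integers $d,n\ge 0$, a set $Y$ of $n$ further column indices, a totally unimodular integer matrix $U$ with $d+n$ rows and columns indexed by $E\sqcup Y$, and non-singular rational diagonal matrices $T$ and $D$ of sizes $d+n$ and $|E|+n$, such that $d$ columns of $U$ indexed by elements of $E$, followed by the $n$ columns indexed by $Y$, form an identity matrix, and such that for every integer $k\ge 0$ the matrix $T^kUD^k$ has integer entries and $\mathcal A^k$ is represented by the list $(T^kUD^k)/Y_k$. Here $Y_k$ is the list of columns of $T^kUD^k$ indexed by $Y$, and $(T^kUD^k)/Y_k$ is the list of the images of the columns indexed by $E$ in $\mathbb Z^{d+n}/\langle Y_k\rangle$. In particular (case $k=1$), $\mathcal A$ itself is represented by $(TUD)/Y_1$. -/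

import Mathlib

/-! ## Arithmetic matroids -/

/-- The interval `[R, S]` is a molecule of the matroid `M`, with decomposition
`S = R ∪ F ∪ T` (disjoint union): `rk A = rk R + |A ∩ F|` for all `A ∈ [R, S]`. -/
structure IsMolecule {E : Type*} [DecidableEq E] (M : Matroid E) (R S F T : Finset E) : Prop where
  disjoint_RF : Disjoint R F
  disjoint_RT : Disjoint R T
  disjoint_FT : Disjoint F T
  eq_union : S = R ∪ F ∪ T
  rank_eq : ∀ A : Finset E, R ⊆ A → A ⊆ S →
    M.eRk (A : Set E) = M.eRk (R : Set E) + ((A ∩ F).card : ℕ∞)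

/-- An arithmetic matroid whose ground set is the finite type `E`. -/
structure ArithmeticMatroid (E : Type*) [Fintype E] [DecidableEq E] where
  /-- the underlying matroid -/
  matroid : Matroid E
  ground_eq : matroid.E = Set.univ
  /-- the multiplicity function -/
  mult : Finset E → ℕ
  mult_pos : ∀ A, 0 < mult A
  /-- axiom (P) -/
  molecule_nonneg : ∀ R S F T : Finset E, IsMolecule matroid R S F T →
    0 ≤ (-1 : ℤ) ^ T.card * ∑ A ∈ Finset.Icc R S, (-1 : ℤ) ^ (S.card - A.card) * (mult A : ℤ)
  /-- axiom (A1), case of equal rank -/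
  mult_insert_dvd : ∀ (A : Finset E) (e : E),
    matroid.eRk ((insert e A : Finset E) : Set E) = matroid.eRk (A : Set E) →
      mult (insert e A) ∣ mult A
  /-- axiom (A1), case of distinct ranks -/
  mult_dvd_insert : ∀ (A : Finset E) (e : E),
    matroid.eRk ((insert e A : Finset E) : Set E) ≠ matroid.eRk (A : Set E) →
      mult A ∣ mult (insert e A)
  /-- axiom (A2) -/
  molecule_mul : ∀ R S F T : Finset E, IsMolecule matroid R S F T →
    mult R * mult S = mult (R ∪ F) * mult (R ∪ T)

/-! ### Powers

To see that the powers of the multiplicity function again satisfy the axioms, only axiom (P)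
needs an argument: it holds for the product of two functions that satisfy it. -/

namespace ArithmeticMatroid

/-- The signed alternating sum over the subsets of `U`; the sign is the product of `σ` over `U`. -/
def altSum {E : Type*} (σ : E → ℤ) (U : Finset E) (f : Finset E → ℤ) : ℤ :=
  (∏ x ∈ U, σ x) * ∑ A ∈ U.powerset, (-1 : ℤ) ^ (U.card - A.card) * f A

theorem altSum_insert {E : Type*} [DecidableEq E] (σ : E → ℤ) {e : E} {U : Finset E} (he : e ∉ U)
    (f : Finset E → ℤ) :
    altSum σ (insert e U) f = σ e * (altSum σ U (fun A => f (insert e A)) - altSum σ U f) := by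
  unfold altSum
  rw [Finset.prod_insert he, Finset.sum_powerset_insert he]
  have h1 : ∑ A ∈ U.powerset, (-1 : ℤ) ^ ((insert e U).card - A.card) * f A
      = - ∑ A ∈ U.powerset, (-1 : ℤ) ^ (U.card - A.card) * f A := by
    rw [← Finset.sum_neg_distrib]
    refine Finset.sum_congr rfl fun A hA => ?_
    have hc := Finset.card_le_card (Finset.mem_powerset.1 hA)
    rw [Finset.card_insert_of_notMem he, Nat.succ_sub hc, pow_succ]
    ring
  have h2 : ∑ A ∈ U.powerset, (-1 : ℤ) ^ ((insert e U).card - (insert e A).card) * f (insert e A)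
      = ∑ A ∈ U.powerset, (-1 : ℤ) ^ (U.card - A.card) * f (insert e A) := by
    refine Finset.sum_congr rfl fun A hA => ?_
    have hA' : e ∉ A := fun h => he (Finset.mem_powerset.1 hA h)
    rw [Finset.card_insert_of_notMem he, Finset.card_insert_of_notMem hA', Nat.add_sub_add_right]
  rw [h1, h2]
  ring

theorem altSum_add {E : Type*} (σ : E → ℤ) (U : Finset E) (f g : Finset E → ℤ) :
    altSum σ U (fun A => f A + g A) = altSum σ U f + altSum σ U g := by
  simp only [altSum, mul_add, Finset.sum_add_distrib]

theorem altSum_sub {E : Type*} (σ : E → ℤ) (U : Finset E) (f g : Finset E → ℤ) :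
    altSum σ U (fun A => f A - g A) = altSum σ U f - altSum σ U g := by
  simp only [altSum, mul_sub, Finset.sum_sub_distrib]

theorem altSum_smul {E : Type*} (σ : E → ℤ) (U : Finset E) (c : ℤ) (f : Finset E → ℤ) :
    altSum σ U (fun A => c * f A) = c * altSum σ U f := by
  simp only [altSum, Finset.mul_sum]
  refine Finset.sum_congr rfl fun A _ => by ring

theorem altSum_mul_nonneg {E : Type*} [DecidableEq E] (σ : E → ℤ) (hσ : ∀ x, σ x = 1 ∨ σ x = -1)
    (W : Finset E) : ∀ f g : Finset E → ℤ,
    (∀ B U, Disjoint B U → B ∪ U ⊆ W → 0 ≤ altSum σ U (fun A => f (B ∪ A))) →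
    (∀ B U, Disjoint B U → B ∪ U ⊆ W → 0 ≤ altSum σ U (fun A => g (B ∪ A))) →
    0 ≤ altSum σ W (fun A => f A * g A) := by
  induction W using Finset.induction_on with
  | empty =>
    intro f g hf hg
    have h1 := hf ∅ ∅ (by simp) (by simp)
    have h2 := hg ∅ ∅ (by simp) (by simp)
    simp [altSum] at h1 h2 ⊢
    positivity
  | insert e W he ih =>
    intro f g hf hg
    -- good functions are stable under restriction, translation and signed difference
    have restr : ∀ h : Finset E → ℤ,
        (∀ B U, Disjoint B U → B ∪ U ⊆ insert e W → 0 ≤ altSum σ U (fun A => h (B ∪ A))) →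
        (∀ B U, Disjoint B U → B ∪ U ⊆ W → 0 ≤ altSum σ U (fun A => h (B ∪ A))) :=
      fun h hh B U hd hs => hh B U hd (hs.trans (Finset.subset_insert _ _))
    have trans : ∀ h : Finset E → ℤ,
        (∀ B U, Disjoint B U → B ∪ U ⊆ insert e W → 0 ≤ altSum σ U (fun A => h (B ∪ A))) →
        (∀ B U, Disjoint B U → B ∪ U ⊆ W → 0 ≤ altSum σ U (fun A => h (insert e (B ∪ A)))) := by
      intro h hh B U hd hs
      have heU : e ∉ U := fun h' => he (hs (Finset.mem_union_right _ h'))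
      have := hh (insert e B) U (by simp [Finset.disjoint_insert_left, heU, hd])
        (by rw [Finset.insert_union]; exact Finset.insert_subset_insert _ hs)
      simpa only [Finset.insert_union] using this
    have diff : ∀ h : Finset E → ℤ,
        (∀ B U, Disjoint B U → B ∪ U ⊆ insert e W → 0 ≤ altSum σ U (fun A => h (B ∪ A))) →
        (∀ B U, Disjoint B U → B ∪ U ⊆ W →
          0 ≤ altSum σ U (fun A => σ e * (h (insert e (B ∪ A)) - h (B ∪ A)))) := by
      intro h hh B U hd hs
      have heU : e ∉ U := fun h' => he (hs (Finset.mem_union_right _ h'))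
      have heB : e ∉ B := fun h' => he (hs (Finset.mem_union_left _ h'))
      have := hh B (insert e U) (by simp [Finset.disjoint_insert_right, heB, hd])
        (by rw [Finset.union_insert]; exact Finset.insert_subset_insert _ hs)
      rw [altSum_insert σ heU] at this
      rw [altSum_smul, altSum_sub]
      simpa only [Finset.union_insert] using this
    rw [altSum_insert σ he, ← altSum_sub, ← altSum_smul]
    rcases hσ e with h1 | h1
    · have e1 : (fun A => σ e * (f (insert e A) * g (insert e A) - f A * g A)) =
          fun A => (σ e * (f (insert e A) - f A)) * g (insert e A) +
            f A * (σ e * (g (insert e A) - g A)) := by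
        funext A; ring
      rw [e1, altSum_add]
      exact add_nonneg (ih _ _ (diff f hf) (trans g hg)) (ih _ _ (restr f hf) (diff g hg))
    · have e1 : (fun A => σ e * (f (insert e A) * g (insert e A) - f A * g A)) =
          fun A => (σ e * (f (insert e A) - f A)) * g A +
            f (insert e A) * (σ e * (g (insert e A) - g A)) := by
        funext A; ring
      rw [e1, altSum_add]
      exact add_nonneg (ih _ _ (diff f hf) (restr g hg)) (ih _ _ (trans f hf) (diff g hg))

theorem molecule_sum_eq {E : Type*} [DecidableEq E] {M : Matroid E} {R S F T : Finset E}
    (h : IsMolecule M R S F T) (m : Finset E → ℤ) :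
    (-1 : ℤ) ^ T.card * ∑ A ∈ Finset.Icc R S, (-1 : ℤ) ^ (S.card - A.card) * m A =
      altSum (fun x => if x ∈ T then -1 else 1) (F ∪ T) (fun A => m (R ∪ A)) := by
  have hd : Disjoint R (F ∪ T) := Finset.disjoint_union_right.2 ⟨h.disjoint_RF, h.disjoint_RT⟩
  have hS : S = R ∪ (F ∪ T) := by rw [h.eq_union, Finset.union_assoc]
  unfold altSum
  congr 1
  · rw [Finset.prod_union h.disjoint_FT, Finset.prod_eq_one, one_mul,
      Finset.prod_congr rfl (g := fun _ => (-1 : ℤ)), Finset.prod_const]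
    · intro x hx; simp [hx]
    · intro x hx; simp [Finset.disjoint_left.1 h.disjoint_FT hx]
  · symm
    refine Finset.sum_bij' (fun A _ => R ∪ A) (fun A _ => A \ R) ?_ ?_ ?_ ?_ ?_
    · intro A hA
      rw [Finset.mem_powerset] at hA
      rw [Finset.mem_Icc, hS]
      exact ⟨Finset.subset_union_left, Finset.union_subset_union_right hA⟩
    · intro A hA
      rw [Finset.mem_Icc, hS] at hA
      rw [Finset.mem_powerset]
      intro x hx
      rw [Finset.mem_sdiff] at hx
      exact (Finset.mem_union.1 (hA.2 hx.1)).resolve_left hx.2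
    · intro A hA
      rw [Finset.mem_powerset] at hA
      rw [Finset.union_sdiff_cancel_left (hd.mono_right hA)]
    · intro A hA
      rw [Finset.mem_Icc] at hA
      exact Finset.union_sdiff_of_subset hA.1
    · intro A hA
      rw [Finset.mem_powerset] at hA
      rw [hS, Finset.card_union_of_disjoint hd, Finset.card_union_of_disjoint (hd.mono_right hA),
        Nat.add_sub_add_left]

theorem IsMolecule.sub {E : Type*} [DecidableEq E] {M : Matroid E} {R S F T B U : Finset E}
    (h : IsMolecule M R S F T) (hd : Disjoint B U) (hs : B ∪ U ⊆ F ∪ T) :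
    IsMolecule M (R ∪ B) (R ∪ B ∪ U) (U ∩ F) (U ∩ T) := by
  have hB : B ⊆ F ∪ T := Finset.subset_union_left.trans hs
  have hU : U ⊆ F ∪ T := Finset.subset_union_right.trans hs
  have hRU : Disjoint R U :=
    (Finset.disjoint_union_right.2 ⟨h.disjoint_RF, h.disjoint_RT⟩).mono_right hU
  have hRBU : Disjoint (R ∪ B) U := Finset.disjoint_union_left.2 ⟨hRU, hd⟩
  have hS : S = R ∪ (F ∪ T) := by rw [h.eq_union, Finset.union_assoc]
  have hRBS : R ∪ B ⊆ S := by rw [hS]; exact Finset.union_subset_union_right hB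
  have hRBUS : R ∪ B ∪ U ⊆ S := by
    rw [hS, Finset.union_assoc]; exact Finset.union_subset_union_right hs
  refine ⟨hRBU.mono_right Finset.inter_subset_left, hRBU.mono_right Finset.inter_subset_left,
    h.disjoint_FT.mono Finset.inter_subset_right Finset.inter_subset_right, ?_, ?_⟩
  · rw [Finset.union_assoc _ (U ∩ F), ← Finset.inter_union_distrib_left,
      Finset.inter_eq_left.2 hU]
  · intro A h1 h2
    rw [h.rank_eq A (Finset.subset_union_left.trans h1) (h2.trans hRBUS),
      h.rank_eq (R ∪ B) Finset.subset_union_left hRBS, add_assoc]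
    congr 1
    rw [← Nat.cast_add, ← Finset.card_union_of_disjoint]
    · congr 2
      ext x
      have hx1 := @h1 x
      have hx2 := @h2 x
      simp only [Finset.mem_inter, Finset.mem_union] at *
      tauto
    · rw [Finset.disjoint_left]
      intro x hx hx'
      simp only [Finset.mem_inter] at hx hx'
      exact Finset.disjoint_left.1 hRBU hx.1 hx'.2.1

theorem molecule_nonneg_mul {E : Type*} [DecidableEq E] {M : Matroid E} {m₁ m₂ : Finset E → ℤ}
    (h₁ : ∀ R S F T : Finset E, IsMolecule M R S F T →
      0 ≤ (-1 : ℤ) ^ T.card * ∑ A ∈ Finset.Icc R S, (-1 : ℤ) ^ (S.card - A.card) * m₁ A)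
    (h₂ : ∀ R S F T : Finset E, IsMolecule M R S F T →
      0 ≤ (-1 : ℤ) ^ T.card * ∑ A ∈ Finset.Icc R S, (-1 : ℤ) ^ (S.card - A.card) * m₂ A)
    {R S F T : Finset E} (h : IsMolecule M R S F T) :
    0 ≤ (-1 : ℤ) ^ T.card *
      ∑ A ∈ Finset.Icc R S, (-1 : ℤ) ^ (S.card - A.card) * (m₁ A * m₂ A) := by
  have key : ∀ m : Finset E → ℤ,
      (∀ R S F T : Finset E, IsMolecule M R S F T →
        0 ≤ (-1 : ℤ) ^ T.card * ∑ A ∈ Finset.Icc R S, (-1 : ℤ) ^ (S.card - A.card) * m A) →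
      ∀ B U, Disjoint B U → B ∪ U ⊆ F ∪ T →
        0 ≤ altSum (fun x => if x ∈ T then -1 else 1) U (fun A => m (R ∪ (B ∪ A))) := by
    intro m hm B U hd hs
    have hsub := IsMolecule.sub h hd hs
    have h0 := hm _ _ _ _ hsub
    rw [molecule_sum_eq hsub m] at h0
    have hU : U ∩ F ∪ U ∩ T = U := by
      rw [← Finset.inter_union_distrib_left, Finset.inter_eq_left]
      exact Finset.subset_union_right.trans hs
    rw [hU] at h0
    convert h0 using 1
    unfold altSum
    congr 1
    · exact Finset.prod_congr rfl fun x hx => by simp [hx]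
    · simp only [Finset.union_assoc]
  rw [molecule_sum_eq h (fun A => m₁ A * m₂ A)]
  exact altSum_mul_nonneg _ (fun x => by by_cases hx : x ∈ T <;> simp [hx]) (F ∪ T)
    (fun A => m₁ (R ∪ A)) (fun A => m₂ (R ∪ A)) (key m₁ h₁) (key m₂ h₂)

theorem molecule_nonneg_one {E : Type*} [DecidableEq E] {M : Matroid E} {R S F T : Finset E}
    (h : IsMolecule M R S F T) :
    0 ≤ (-1 : ℤ) ^ T.card * ∑ A ∈ Finset.Icc R S, (-1 : ℤ) ^ (S.card - A.card) * (1 : ℤ) := by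
  rw [molecule_sum_eq h (fun _ => 1)]
  rcases (F ∪ T).eq_empty_or_nonempty with h0 | ⟨e, he⟩
  · simp [h0, altSum]
  · rw [← Finset.insert_erase he, altSum_insert _ (Finset.notMem_erase _ _)]
    simp

/-- The power `A ^ k`: the same matroid, with the `k`-th power of the multiplicity function. -/
def power {E : Type*} [Fintype E] [DecidableEq E] (A : ArithmeticMatroid E) (k : ℕ) :
    ArithmeticMatroid E where
  matroid := A.matroid
  ground_eq := A.ground_eq
  mult S := A.mult S ^ k
  mult_pos S := pow_pos (A.mult_pos S) k
  molecule_nonneg := by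
    induction k with
    | zero =>
      intro R S F T h
      simpa using molecule_nonneg_one h
    | succ k ih =>
      intro R S F T h
      have := molecule_nonneg_mul (m₁ := fun B => ((A.mult B ^ k : ℕ) : ℤ))
        (m₂ := fun B => (A.mult B : ℤ)) ih A.molecule_nonneg h
      simpa only [pow_succ, Nat.cast_mul] using this
  mult_insert_dvd S e h := pow_dvd_pow_of_dvd (A.mult_insert_dvd S e h) k
  mult_dvd_insert S e h := pow_dvd_pow_of_dvd (A.mult_dvd_insert S e h) k
  molecule_mul R S F T h := by
    rw [← mul_pow, ← mul_pow, A.molecule_mul R S F T h]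

end ArithmeticMatroid

/-! ### Representations -/

/-- The list of vectors `X = (x_e)` represents the matroid `M`: the independent sets of `M` are
the subsets of the ground set on which `X` is linearly independent. It is used over a field and
over `ℤ` (lists of vectors in a lattice). -/
def RepresentsMatroid (R : Type*) [Semiring R] {V E : Type*} [AddCommMonoid V] [Module R V]
    (M : Matroid E) (X : E → V) : Prop :=
  ∀ I ⊆ M.E, (M.Indep I ↔ LinearIndepOn R X I)

/-- A matroid is regular if it is representable over every field. (A list of vectors over
a prime field represents the same matroid over every extension, and prime fields live in `Type`,
so quantifying over fields in `Type` is no restriction.) -/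
def IsRegularMatroid {E : Type*} (M : Matroid E) : Prop :=
  ∀ (K : Type) [Field K], ∃ (d : ℕ) (X : E → Fin d → K), RepresentsMatroid K M X

/-- For a subgroup `H` of `G`, the subgroup of all elements of `G` that have a positive multiple
in `H`. If `G` is finitely generated, it is the largest subgroup of `G` in which `H` has finite
index, see `isGreatest_isolatedHull`. -/
def isolatedHull {G : Type*} [AddCommGroup G] (H : AddSubgroup G) : AddSubgroup G where
  carrier := {g | ∃ n : ℕ, 0 < n ∧ n • g ∈ H}
  zero_mem' := ⟨1, one_pos, by simp⟩
  add_mem' := by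
    rintro a b ⟨n, hn, ha⟩ ⟨m, hm, hb⟩
    refine ⟨n * m, Nat.mul_pos hn hm, ?_⟩
    rw [smul_add, mul_comm n m, mul_smul, mul_comm m n, mul_smul]
    exact H.add_mem (H.nsmul_mem ha m) (H.nsmul_mem hb n)
  neg_mem' := by
    rintro a ⟨n, hn, ha⟩
    exact ⟨n, hn, by rw [smul_neg]; exact H.neg_mem ha⟩

theorem isGreatest_isolatedHull {G : Type*} [AddCommGroup G] [AddGroup.FG G] (H : AddSubgroup G) :
    IsGreatest {K : AddSubgroup G | H ≤ K ∧ H.relIndex K ≠ 0} (isolatedHull H) := by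
  refine ⟨⟨fun g hg => ⟨1, one_pos, by simpa using hg⟩, ?_⟩, ?_⟩
  · have : Module.Finite ℤ G := Module.Finite.iff_addGroup_fg.2 inferInstance
    let K := isolatedHull H
    have hK : Module.Finite ℤ K := inferInstanceAs (Module.Finite ℤ (AddSubgroup.toIntSubmodule K))
    have hQ : AddGroup.FG (K ⧸ H.addSubgroupOf K) := by
      have : AddGroup.FG K := Module.Finite.iff_addGroup_fg.1 hK
      infer_instance
    have hfin : Finite (K ⧸ H.addSubgroupOf K) := by
      refine AddCommGroup.finite_of_fg_isAddTorsion _ ?_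
      intro q
      induction q using QuotientAddGroup.induction_on with
      | H g =>
        obtain ⟨n, hn, hg⟩ := g.2
        rw [isOfFinAddOrder_iff_nsmul_eq_zero]
        refine ⟨n, hn, ?_⟩
        rw [← QuotientAddGroup.mk_nsmul, QuotientAddGroup.eq_zero_iff]
        exact hg
    exact AddSubgroup.index_ne_zero_of_finite (H := H.addSubgroupOf K)
  · rintro K ⟨-, hK⟩ g hg
    exact ⟨H.relIndex K, Nat.pos_of_ne_zero hK,
      AddSubgroup.nsmul_index_mem (H.addSubgroupOf K) ⟨g, hg⟩⟩

namespace ArithmeticMatroid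

/-- The list `X = (x_e)` of elements of the abelian group `G` represents the arithmetic matroid
`A`: its image in the lattice `G / torsion` represents the underlying matroid, and `A.mult S` is
the order of `G_S / ⟨S⟩`, where `⟨S⟩` is the subgroup generated by the `x_e`, `e ∈ S`, and `G_S` is
the maximal subgroup of `G` in which `⟨S⟩` has finite index. -/
def IsRepresentation {E : Type*} [Fintype E] [DecidableEq E] (A : ArithmeticMatroid E)
    {G : Type*} [AddCommGroup G] (X : E → G) : Prop :=
  RepresentsMatroid ℤ A.matroid
      (fun e => (QuotientAddGroup.mk (X e) : G ⧸ AddCommGroup.torsion G)) ∧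
    ∀ S : Finset E, A.mult S =
      (AddSubgroup.closure (X '' (S : Set E))).relIndex
        (isolatedHull (AddSubgroup.closure (X '' (S : Set E))))

/-- An arithmetic matroid is representable if it has a representation by a list of elements of
some finitely generated abelian group. -/
def IsRepresentable {E : Type*} [Fintype E] [DecidableEq E] (A : ArithmeticMatroid E) : Prop :=
  ∃ (G : Type) (_ : AddCommGroup G) (_ : AddGroup.FG G) (X : E → G), A.IsRepresentation X

/-! ### Regular and weakly multiplicative arithmetic matroids -/

/-- An arithmetic matroid is torsion-free if `m(∅) = 1`. -/
def IsTorsionFree {E : Type*} [Fintype E] [DecidableEq E] (A : ArithmeticMatroid E) : Prop :=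
  A.mult ∅ = 1

/-- `B` is a multiplicative basis: a basis with `m(B) = ∏_{x ∈ B} m({x})`. -/
def IsMultiplicativeBasis {E : Type*} [Fintype E] [DecidableEq E] (A : ArithmeticMatroid E)
    (B : Finset E) : Prop :=
  A.matroid.IsBase (B : Set E) ∧ A.mult B = ∏ x ∈ B, A.mult {x}

/-- The arithmetic matroid `A'` on the disjoint union of `E` and `Y` is a lifting of the
arithmetic matroid `A` on `E`, that is `A = A' / Y`: the matroid of `A` is the contraction by `Y`
of the matroid of `A'`, and `m(S) = m'(S ∪ Y)` for all `S ⊆ E`. -/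
def IsLifting {E Y : Type*} [Fintype E] [DecidableEq E] [Fintype Y] [DecidableEq Y]
    (A : ArithmeticMatroid E) (A' : ArithmeticMatroid (E ⊕ Y)) : Prop :=
  A.matroid = (A'.matroid.contract (Set.range Sum.inr)).comap Sum.inl ∧
    ∀ S : Finset E, A.mult S = A'.mult (S.disjSum Finset.univ)

/-- `A` is regular and weakly multiplicative: there is one torsion-free lifting `A'` of `A`,
`A = A' / Y`, that is regular (representable, with a regular underlying matroid) and that has a
multiplicative basis which contains `Y`. A torsion-free `A` that is itself regular with a
multiplicative basis is the case `Y = ∅`. -/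
def IsRegularWeaklyMultiplicative {E : Type*} [Fintype E] [DecidableEq E]
    (A : ArithmeticMatroid E) : Prop :=
  ∃ (Y : Type) (_ : Fintype Y) (_ : DecidableEq Y) (A' : ArithmeticMatroid (E ⊕ Y)),
    A.IsLifting A' ∧ A'.IsTorsionFree ∧
    A'.IsRepresentable ∧ IsRegularMatroid A'.matroid ∧
    ∃ B : Finset (E ⊕ Y), A'.IsMultiplicativeBasis B ∧ ∀ y : Y, Sum.inr y ∈ B

end ArithmeticMatroid

/-- For an integer matrix `Z` with columns indexed by the disjoint union of `E` and `Y`, the list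
`Z / Y`: the columns indexed by `E`, in the quotient of the column lattice `ℤ^ι` by the
subgroup generated by the columns indexed by `Y`. -/
def quotientList {ι E Y : Type*} (Z : Matrix ι (E ⊕ Y) ℤ) (e : E) :
    (ι → ℤ) ⧸ AddSubgroup.closure (Set.range fun y : Y => Z.col (Sum.inr y)) :=
  QuotientAddGroup.mk (Z.col (Sum.inl e))

/-! In a lattice, the index of `⟨S⟩` in its saturation is the gcd of the minors of the columns in
`S`, taken in the largest size that has a nonzero minor (`isMinorGcd_relIndex`). Suppose a
representing matrix is `T U D` with `U` totally unimodular and `T`, `D` positive diagonal. Each of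
its minors is zero or, up to sign, a product of diagonal entries. Replacing `T`, `D` by their `k`-th
powers therefore raises every nonzero minor to the `k`-th power up to sign, hence also every
multiplicity (`IsMinorGcd.pow`), while the matroid stays the same. Such a factorization is found for
the lifting `A'`; dividing by the columns in `Y` then represents `A` and its powers
(`IsLifting.isRepresentation_mk`).

For the factorization, represent `A'` in a lattice of the same rank. A basis column `x` is divisible
by `m'({x})`, and `m'(B) = ∏ m'({x})` says that the quotients form a unimodular matrix, so a change
of coordinates makes the basis diagonal (`exists_diagonal`). Regularity gives a matrix over `ZMod 2`
in which the same basis consists of unit vectors. With a diagonal basis the matroid decides which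
minors vanish (`det_submatrix_ne_zero_iff`), so the integer matrix `X` and the binary matrix have
the same vanishing minors.

This makes `|X|` a scaling of its support matrix (`exists_scaling`): a chordless cycle in the
bipartite support graph gives a binary submatrix with two ones per column, which is singular; the
rational submatrix is then singular too, and this is the consistency condition for the scaling. The
sign matrix `U` of `X` reduces to the binary matrix modulo two, so its even minors vanish, and
pivoting shows that it is totally unimodular (`Matrix.natAbs_det_le_one`). -/

/-! ### Greatest common divisors of maximal minors -/

open Matrix in
/-- A matrix with a right inverse over `ℤ` has, for every prime `p`, a maximal minor that is not
divisible by `p`. -/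
theorem exists_not_dvd_det_submatrix {r : ℕ} {σ : Type*} [Fintype σ]
    (R : Matrix (Fin r) σ ℤ) (W : Matrix σ (Fin r) ℤ) (h : R * W = 1) {p : ℕ} (hp : p.Prime) :
    ∃ g : Fin r → σ, ¬ (p : ℤ) ∣ (R.submatrix id g).det := by
  have : Fact p.Prime := ⟨hp⟩
  let φ := Int.castRingHom (ZMod p)
  have hW : R.map φ * W.map φ = 1 := by
    rw [← Matrix.map_mul, h, Matrix.map_one _ (map_zero φ) (map_one φ)]
  have hspan : Submodule.span (ZMod p) (Set.range (R.map φ).col) = ⊤ := by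
    rw [← Matrix.range_mulVecLin, LinearMap.range_eq_top]
    intro v
    exact ⟨(W.map φ) *ᵥ v, by simp [Matrix.mulVec_mulVec, hW]⟩
  -- Modulo `p` the columns span, so some of them form a basis; these are the columns of the minor.
  obtain ⟨κ, a, -, hs, hli⟩ := exists_linearIndependent' (ZMod p) (R.map φ).col
  rw [hspan] at hs
  let b := Module.Basis.mk hli hs.ge
  let e : Fin r ≃ κ := (Pi.basisFun (ZMod p) (Fin r)).indexEquiv b
  refine ⟨a ∘ e, fun hd => ?_⟩
  have h0 : ((R.map φ).submatrix id (a ∘ e)).det = 0 := by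
    rw [Matrix.submatrix_map, ← RingHom.mapMatrix_apply, ← RingHom.map_det]
    exact (ZMod.intCast_zmod_eq_zero_iff_dvd _ _).2 hd
  have h1 : LinearIndependent (ZMod p) ((R.map φ).submatrix id (a ∘ e)).col :=
    hli.comp e e.injective
  rw [Matrix.linearIndependent_cols_iff_isUnit, Matrix.isUnit_iff_isUnit_det, h0] at h1
  exact not_isUnit_zero h1

/-- `m` is the greatest common divisor of the nonzero minors of `Z` of the largest size. -/
def IsMinorGcd {ι σ : Type*} (Z : Matrix ι σ ℤ) (m : ℕ) : Prop :=
  ∃ r : ℕ, (∀ s, r < s → ∀ (f : Fin s → ι) (g : Fin s → σ), (Z.submatrix f g).det = 0) ∧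
    (∀ (f : Fin r → ι) (g : Fin r → σ), (m : ℤ) ∣ (Z.submatrix f g).det) ∧
    ∀ p : ℕ, p.Prime → ∃ (f : Fin r → ι) (g : Fin r → σ), ¬ ((m * p : ℕ) : ℤ) ∣ (Z.submatrix f g).det

theorem Matrix.det_mul_eq_zero_of_lt {R : Type*} [CommRing R] [IsDomain R] {r s : ℕ} (h : r < s)
    (A : Matrix (Fin s) (Fin r) R) (B : Matrix (Fin r) (Fin s) R) : (A * B).det = 0 := by
  by_contra hd
  have h1 := Matrix.rank_of_det_ne_zero hd
  have h2 := (Matrix.rank_mul_le_left A B).trans A.rank_le_width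
  simp at h1
  omega

/-- The inner dimension is `r`, so an `r`-minor of the product is a minor of `P` times `det Q` times
a minor of `R`. The one-sided inverses give, for each prime, minors of `P` and `R` prime to it, so
only `det Q` contributes to the gcd. -/
theorem isMinorGcd_mul_mul {ι σ : Type*} [Fintype ι] [Fintype σ] {r : ℕ}
    (P : Matrix ι (Fin r) ℤ) (Q : Matrix (Fin r) (Fin r) ℤ) (R : Matrix (Fin r) σ ℤ)
    (L : Matrix (Fin r) ι ℤ) (W : Matrix σ (Fin r) ℤ) (hL : L * P = 1) (hW : R * W = 1)
    (hQ : Q.det ≠ 0) : IsMinorGcd (P * (Q * R)) Q.det.natAbs := by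
  have key : ∀ {s : ℕ} (f : Fin s → ι) (g : Fin s → σ),
      (P * (Q * R)).submatrix f g = P.submatrix f id * (Q * R.submatrix id g) := by
    intro s f g
    ext i j
    simp [Matrix.mul_apply]
  refine ⟨r, fun s hs f g => ?_, fun f g => ?_, fun p hp => ?_⟩
  · rw [key, Matrix.det_mul_eq_zero_of_lt hs]
  · rw [key, Matrix.det_mul, Matrix.det_mul, Int.natAbs_dvd]
    exact (dvd_mul_right _ _).mul_left _
  · obtain ⟨g, hg⟩ := exists_not_dvd_det_submatrix R W hW hp
    obtain ⟨f, hf⟩ := exists_not_dvd_det_submatrix P.transpose L.transpose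
      (by rw [← Matrix.transpose_mul, hL, Matrix.transpose_one]) hp
    refine ⟨f, g, ?_⟩
    rw [key, Matrix.det_mul, Matrix.det_mul]
    rw [← Matrix.det_transpose, Matrix.transpose_submatrix, Matrix.transpose_transpose] at hf
    intro h
    have h2 : Q.det * p ∣ Q.det * ((P.submatrix f id).det * (R.submatrix id g).det) := by
      rw [Int.natCast_dvd] at h
      rw [← Int.natAbs_dvd_natAbs]
      simp only [Int.natAbs_mul, Int.natAbs_natCast] at h ⊢
      rwa [Nat.mul_left_comm] at h
    rcases (Nat.prime_iff_prime_int.1 hp).dvd_or_dvd ((mul_dvd_mul_iff_left hQ).1 h2) with h | h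
    exacts [hf h, hg h]

theorem IsMinorGcd.unique {ι σ : Type*} {Z : Matrix ι σ ℤ} {m m' : ℕ}
    (h : IsMinorGcd Z m) (h' : IsMinorGcd Z m') : m = m' := by
  obtain ⟨r, h1, h2, h3⟩ := h
  obtain ⟨r', h1', h2', h3'⟩ := h'
  have hr : r = r' := by
    rcases lt_trichotomy r r' with hlt | heq | hlt
    -- The prime 2 is arbitrary: non-divisibility merely exhibits a nonzero minor of the critical
    -- size.
    · obtain ⟨f, g, hfg⟩ := h3' 2 Nat.prime_two
      exact absurd (by rw [h1 _ hlt]; exact dvd_zero _) hfg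
    · exact heq
    · obtain ⟨f, g, hfg⟩ := h3 2 Nat.prime_two
      exact absurd (by rw [h1' _ hlt]; exact dvd_zero _) hfg
  subst hr
  have key : ∀ a b : ℕ, (∀ (f : Fin r → ι) (g : Fin r → σ), (a : ℤ) ∣ (Z.submatrix f g).det) →
      (∀ (f : Fin r → ι) (g : Fin r → σ), (b : ℤ) ∣ (Z.submatrix f g).det) →
      (∀ p : ℕ, p.Prime → ∃ (f : Fin r → ι) (g : Fin r → σ),
        ¬ ((a * p : ℕ) : ℤ) ∣ (Z.submatrix f g).det) → b ∣ a := by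
    intro a b ha hb hap
    -- The lcm of `a` and `b` divides all minors. A prime factor of `lcm / a` would contradict the
    -- maximality of `a`.
    obtain ⟨q, hq⟩ := Nat.dvd_lcm_left a b
    have hall : ∀ (f : Fin r → ι) (g : Fin r → σ), ((a * q : ℕ) : ℤ) ∣ (Z.submatrix f g).det := by
      intro f g
      rw [← hq]
      exact Int.natCast_dvd.2 (Nat.lcm_dvd (Int.natCast_dvd.1 (ha f g)) (Int.natCast_dvd.1 (hb f g)))
    have hq1 : q = 1 := by
      by_contra hne
      obtain ⟨p, hp, hpq⟩ := Nat.exists_prime_and_dvd hne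
      obtain ⟨f, g, hfg⟩ := hap p hp
      exact hfg ((Int.natCast_dvd_natCast.2 (Nat.mul_dvd_mul_left a hpq)).trans (hall f g))
    rw [hq1, mul_one] at hq
    exact hq ▸ Nat.dvd_lcm_right a b
  exact Nat.dvd_antisymm (key _ _ h2' h2 h3') (key _ _ h2 h2' h3)

/-- If the minors of `Z'` are, up to sign, the `k`-th powers of the minors of `Z`, except that
vanishing minors correspond to vanishing minors, then maximal minor gcds are `k`-th powers. -/
theorem IsMinorGcd.pow {ι σ : Type*} {Z Z' : Matrix ι σ ℤ} {k : ℕ}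
    (hZ : ∀ (s : ℕ) (f : Fin s → ι) (g : Fin s → σ),
      ((Z.submatrix f g).det = 0 → (Z'.submatrix f g).det = 0) ∧
      ((Z.submatrix f g).det ≠ 0 →
        (Z'.submatrix f g).det.natAbs = (Z.submatrix f g).det.natAbs ^ k))
    {m : ℕ} (h : IsMinorGcd Z m) : IsMinorGcd Z' (m ^ k) := by
  obtain ⟨r, h1, h2, h3⟩ := h
  refine ⟨r, fun s hs f g => (hZ s f g).1 (h1 s hs f g), fun f g => ?_, fun p hp => ?_⟩
  · by_cases h0 : (Z.submatrix f g).det = 0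
    · rw [(hZ r f g).1 h0]; exact dvd_zero _
    · rw [Int.natCast_dvd, (hZ r f g).2 h0]
      exact pow_dvd_pow_of_dvd (Int.natCast_dvd.1 (h2 f g)) k
  · obtain ⟨f, g, hfg⟩ := h3 p hp
    refine ⟨f, g, fun hd => hfg ?_⟩
    have h0 : (Z.submatrix f g).det ≠ 0 := fun h0 => hfg (by rw [h0]; exact dvd_zero _)
    rw [Int.natCast_dvd, (hZ r f g).2 h0] at hd
    obtain ⟨q, hq⟩ := Int.natCast_dvd.1 (h2 f g)
    have hm : m ≠ 0 := by
      rintro rfl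
      exact h0 (by simpa using hq)
    rw [hq, mul_pow, Nat.mul_dvd_mul_iff_left (pow_pos (Nat.pos_of_ne_zero hm) k)] at hd
    rw [Int.natCast_dvd, hq]
    exact Nat.mul_dvd_mul_left _ (hp.dvd_of_dvd_pow hd)

/-! ### The index in the saturation as a gcd of minors -/

theorem closure_le_isolatedHull {G : Type*} [AddCommGroup G] (H : AddSubgroup G) :
    H ≤ isolatedHull H := fun g hg => ⟨1, one_pos, by simpa using hg⟩

/-- A saturated subgroup of a finitely generated lattice is a direct summand. -/
theorem exists_retraction_isolatedHull {G : Type*} [AddCommGroup G] [Module.Finite ℤ G]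
    (H : AddSubgroup G) :
    ∃ ρ : G →ₗ[ℤ] (isolatedHull H).toIntSubmodule, ∀ x : (isolatedHull H).toIntSubmodule,
      ρ x = x := by
  set N := (isolatedHull H).toIntSubmodule with hN
  have htf : Module.IsTorsionFree ℤ (G ⧸ N) := by
    rw [Module.isTorsionFree_int_iff_isAddTorsionFree]
    refine ⟨fun n hn a b hab => ?_⟩
    obtain ⟨a, rfl⟩ := N.mkQ_surjective a
    obtain ⟨b, rfl⟩ := N.mkQ_surjective b
    simp only [← map_nsmul] at hab
    rw [Submodule.mkQ_apply, Submodule.mkQ_apply, Submodule.Quotient.eq, ← smul_sub] at hab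
    rw [Submodule.mkQ_apply, Submodule.mkQ_apply, Submodule.Quotient.eq]
    obtain ⟨k, hk, hab⟩ := hab
    exact ⟨k * n, Nat.mul_pos hk (Nat.pos_of_ne_zero hn), by rwa [mul_smul]⟩
  have : Module.Free ℤ (G ⧸ N) := inferInstance
  -- The quotient by a saturated subgroup is free, so the projection has a section `s`, and `id - s
  -- ∘ mkQ` is the retraction.
  obtain ⟨s, hs⟩ := Module.projective_lifting_property N.mkQ LinearMap.id N.mkQ_surjective
  have hmem : ∀ x, (LinearMap.id - s ∘ₗ N.mkQ : G →ₗ[ℤ] G) x ∈ N := by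
    intro x
    rw [← Submodule.Quotient.mk_eq_zero, ← Submodule.mkQ_apply]
    have := LinearMap.congr_fun hs (N.mkQ x)
    simp only [LinearMap.comp_apply, LinearMap.id_apply] at this
    rw [LinearMap.sub_apply, map_sub, sub_eq_zero]
    exact this.symm
  refine ⟨LinearMap.codRestrict N (LinearMap.id - s ∘ₗ N.mkQ) hmem, fun x => Subtype.ext ?_⟩
  have : N.mkQ (x : G) = 0 := by simp
  simp [this]

/-- Factor `X = P Q R`: the columns of `P` are a basis of the saturation, those of `Q` a basis of
the column group in these coordinates, and `R` holds coordinates of the columns of `X`. A retraction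
gives a left inverse of `P`; writing the basis through the generators gives a right inverse of `R`;
and `|det Q|` is the index. -/
theorem isMinorGcd_relIndex {ι σ : Type*} [Fintype ι] [Fintype σ] (X : Matrix ι σ ℤ) :
    IsMinorGcd X ((AddSubgroup.closure (Set.range X.col)).relIndex
      (isolatedHull (AddSubgroup.closure (Set.range X.col)))) := by
  classical
  set H := AddSubgroup.closure (Set.range X.col) with hH
  set N := (isolatedHull H).toIntSubmodule with hN
  obtain ⟨ρ, hρ⟩ : ∃ ρ : (ι → ℤ) →ₗ[ℤ] N, ∀ x : N, ρ x = x := exists_retraction_isolatedHull H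
  have hXN : ∀ s, X.col s ∈ N := fun s =>
    closure_le_isolatedHull H (AddSubgroup.subset_closure ⟨s, rfl⟩)
  let r := Module.finrank ℤ N
  let bN : Module.Basis (Fin r) ℤ N := Module.finBasis ℤ N
  let P : Matrix ι (Fin r) ℤ := Matrix.of fun i j => (bN j : ι → ℤ) i
  let L : Matrix (Fin r) ι ℤ := Matrix.of fun j i => bN.repr (ρ (Pi.single i 1)) j
  let C : Matrix (Fin r) σ ℤ := Matrix.of fun j s => bN.repr ⟨X.col s, hXN s⟩ j
  have hPv : ∀ v, P.mulVec v = ((∑ j, v j • bN j : N) : ι → ℤ) := by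
    intro v
    ext i
    simp [P, Matrix.mulVec, dotProduct, mul_comm]
  have hLv : ∀ v, L.mulVec v = bN.repr (ρ v) := by
    intro v
    ext j
    conv_rhs => rw [pi_eq_sum_univ v]
    simp only [map_sum, map_smul, Finsupp.coe_finsetSum, Finset.sum_apply, Finsupp.coe_smul,
      Pi.smul_apply]
    simp only [L, Matrix.mulVec, dotProduct, Matrix.of_apply, smul_eq_mul]
    refine Finset.sum_congr rfl fun i _ => ?_
    rw [mul_comm]
    congr! 4
    ext k
    simp [Pi.single_apply, eq_comm]
  have hLP : L * P = 1 := by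
    apply Matrix.ext_of_mulVec_single
    intro j
    rw [← Matrix.mulVec_mulVec, hPv, hLv, hρ, Matrix.one_mulVec]
    ext k
    simp [Pi.single_apply, Finsupp.single_apply, eq_comm]
  have hPC : P * C = X := by
    apply Matrix.ext_of_mulVec_single
    intro s
    rw [← Matrix.mulVec_mulVec, hPv]
    have := bN.sum_repr ⟨X.col s, hXN s⟩
    simp only [Matrix.mulVec_single_one]
    exact congrArg Subtype.val this
  let φ : (Fin r → ℤ) →+ (ι → ℤ) := P.mulVecLin.toAddMonoidHom
  have hφ : ∀ v, φ v = P.mulVec v := fun v => rfl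
  have hinj : Function.Injective φ := by
    intro v w hvw
    have := congrArg L.mulVec hvw
    simpa [hφ, Matrix.mulVec_mulVec, hLP] using this
  let K := AddSubgroup.closure (Set.range C.col)
  have hKH : K.map φ = H := by
    rw [AddMonoidHom.map_closure, ← Set.range_comp, hH]
    congr 2
    ext1 s
    rw [Function.comp_apply, hφ, ← hPC]
    rfl
  have hKN : AddSubgroup.map φ ⊤ = isolatedHull H := by
    ext x
    constructor
    · rintro ⟨v, -, rfl⟩
      rw [hφ, hPv]
      exact (∑ j, v j • bN j : N).2
    · intro hx
      refine ⟨bN.repr ⟨x, hx⟩, trivial, ?_⟩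
      rw [hφ, hPv]
      exact congrArg Subtype.val (bN.sum_repr ⟨x, hx⟩)
  have hidx : H.relIndex (isolatedHull H) = K.index := by
    rw [← hKN, ← AddSubgroup.relIndex_top_right, ← hKH,
      AddSubgroup.relIndex_map_map_of_injective _ _ hinj]
  have hne : K.index ≠ 0 := by
    rw [← hidx]
    have : AddGroup.FG (ι → ℤ) := Module.Finite.iff_addGroup_fg.1 inferInstance
    exact (isGreatest_isolatedHull H).1.2
  -- Finite index in `ℤ ^ r` makes `K` free of rank exactly `r`, so `Q` is square.
  obtain ⟨e⟩ := Int.addSubgroup_index_ne_zero_iff.1 hne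
  let bK : Module.Basis (Fin r) ℤ K := Module.Basis.ofEquivFun e.toIntLinearEquiv
  let Q : Matrix (Fin r) (Fin r) ℤ := Matrix.of fun i j => (bK j : Fin r → ℤ) i
  have hQ : K.index = Q.det.natAbs := by
    rw [AddSubgroup.index_eq_natAbs_det (Pi.basisFun ℤ (Fin r)) K bK, Module.Basis.det_apply,
      Module.Basis.coePiBasisFun.toMatrix_eq_transpose]
    rfl
  have hCK : ∀ s, C.col s ∈ K := fun s => AddSubgroup.subset_closure ⟨s, rfl⟩
  let R : Matrix (Fin r) σ ℤ := Matrix.of fun j s => bK.repr ⟨C.col s, hCK s⟩ j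
  have hQR : Q * R = C := by
    ext i s
    have h1 : K.subtype (∑ j, bK.repr ⟨C.col s, hCK s⟩ j • bK j) i = C i s :=
      congrArg (fun x : K => (x : Fin r → ℤ) i) (bK.sum_repr ⟨C.col s, hCK s⟩)
    rw [map_sum, Finset.sum_apply] at h1
    simpa [Q, R, Matrix.mul_apply, mul_comm] using h1
  have hw : ∀ j, ∃ w : σ → ℤ, ∑ s, w s • C.col s = (bK j : Fin r → ℤ) := by
    intro j
    have h1 : (bK j : Fin r → ℤ) ∈ Submodule.span ℤ (Set.range C.col) := by
      rw [← Submodule.mem_toAddSubgroup, Submodule.span_int_eq_addSubgroupClosure]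
      exact (bK j).2
    exact (Submodule.mem_span_range_iff_exists_fun ℤ).1 h1
  choose w hw using hw
  let W : Matrix σ (Fin r) ℤ := Matrix.of fun s j => w j s
  have hCW : C * W = Q := by
    ext i j
    have := congrFun (hw j) i
    simpa [W, Q, Matrix.mul_apply, mul_comm] using this
  have hdet : Q.det ≠ 0 := by
    rw [hQ] at hne
    exact Int.natAbs_ne_zero.1 hne
  have hRW : R * W = 1 := by
    have hz : Q * (R * W - 1) = 0 := by
      rw [Matrix.mul_sub, ← Matrix.mul_assoc, hQR, hCW, Matrix.mul_one, sub_self]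
    ext i j
    have hv := Matrix.eq_zero_of_mulVec_eq_zero hdet (v := (R * W - 1).col j)
      (by rw [← Matrix.mulVec_single_one, Matrix.mulVec_mulVec, hz, Matrix.zero_mulVec])
    have := congrFun hv i
    simpa [sub_eq_zero] using this
  have := isMinorGcd_mul_mul P Q R L W hLP hRW hdet
  rwa [hQR, hPC, ← hQ, ← hidx] at this

/-! ### Representations under embeddings and quotients -/

/-- A relation modulo torsion becomes a true relation after multiplication by a positive integer.
Hence independence can be tested in `G` itself. -/
theorem linearIndepOn_mk_torsion_iff {G E : Type*} [AddCommGroup G] (X : E → G) (I : Set E) :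
    LinearIndepOn ℤ (fun e => (QuotientAddGroup.mk (X e) : G ⧸ AddCommGroup.torsion G)) I ↔
      LinearIndepOn ℤ X I := by
  have key : ∀ (s : Finset I) (g : I → ℤ),
      ∑ i ∈ s, g i • (QuotientAddGroup.mk (X i) : G ⧸ AddCommGroup.torsion G) =
        QuotientAddGroup.mk' (AddCommGroup.torsion G) (∑ i ∈ s, g i • X i) := by
    intro s g
    rw [map_sum]
    rfl
  simp only [LinearIndepOn, linearIndependent_iff', key]
  constructor
  · intro h s g hg
    exact h s g (by rw [hg, map_zero])
  · intro h s g hg i hi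
    rw [QuotientAddGroup.mk'_apply, QuotientAddGroup.eq_zero_iff] at hg
    obtain ⟨n, hn, hg⟩ := isOfFinAddOrder_iff_nsmul_eq_zero.1 hg
    have h1 := h s (fun i => n * g i) (by
      rw [← hg, Finset.smul_sum]
      exact Finset.sum_congr rfl fun i _ => by rw [mul_smul, natCast_zsmul]) i hi
    simpa [hn.ne'] using h1

theorem mem_isolatedHull {G : Type*} [AddCommGroup G] {H : AddSubgroup G} {g : G} :
    g ∈ isolatedHull H ↔ ∃ n : ℕ, 0 < n ∧ n • g ∈ H := Iff.rfl

theorem map_isolatedHull {G G' : Type*} [AddCommGroup G] [AddCommGroup G'] {f : G →+ G'}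
    (hf : Function.Injective f)
    (hsat : ∀ (y : G') (n : ℕ), 0 < n → n • y ∈ f.range → y ∈ f.range) (H : AddSubgroup G) :
    (isolatedHull H).map f = isolatedHull (H.map f) := by
  ext y
  constructor
  · rintro ⟨x, ⟨n, hn, hx⟩, rfl⟩
    exact ⟨n, hn, n • x, hx, map_nsmul f n x⟩
  · rintro ⟨n, hn, z, hz, hzy⟩
    obtain ⟨x, rfl⟩ := hsat y n hn ⟨z, hzy⟩
    refine ⟨x, ⟨n, hn, ?_⟩, rfl⟩
    rw [← map_nsmul] at hzy
    exact hf hzy ▸ hz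

theorem comap_isolatedHull {G G' : Type*} [AddCommGroup G] [AddCommGroup G'] (f : G →+ G')
    (H : AddSubgroup G') : (isolatedHull H).comap f = isolatedHull (H.comap f) := by
  ext x
  simp [mem_isolatedHull]

theorem linearIndepOn_image_iff {R V E F : Type*} [Semiring R] [AddCommMonoid V] [Module R V]
    {f : F → E} (hf : Function.Injective f) (X : E → V) (I : Set F) :
    LinearIndepOn R X (f '' I) ↔ LinearIndepOn R (X ∘ f) I :=
  (linearIndependent_equiv (Equiv.Set.image f I hf)).symm

/-- Any map with the right kernel can replace the quotient map. It serves for the contraction by `Y`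
and for coordinate projections in the study of minors. -/
theorem linearIndepOn_union_iff_of_ker_eq {R V W E : Type*} [Ring R] [AddCommGroup V]
    [AddCommGroup W] [Module R V] [Module R W] {X : E → V} {s t : Set E} (hst : Disjoint s t)
    (π : V →ₗ[R] W) (hπ : LinearMap.ker π = Submodule.span R (X '' s)) :
    LinearIndepOn R X (s ∪ t) ↔ LinearIndepOn R X s ∧ LinearIndepOn R (π ∘ X) t := by
  rw [linearIndepOn_union_iff_quotient hst]
  refine and_congr_right fun _ => ?_
  let ψ := (Submodule.span R (X '' s)).liftQ π hπ.ge
  have hψ : Function.Injective ψ := by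
    rw [← LinearMap.ker_eq_bot, Submodule.ker_liftQ_eq_bot' _ _ hπ.symm]
  have : π ∘ X = ψ ∘ ((Submodule.span R (X '' s)).mkQ ∘ X) := by
    ext e; simp [ψ]
  rw [this]
  exact (LinearMap.linearIndepOn_iff_of_injOn ψ hψ.injOn).symm

namespace ArithmeticMatroid

variable {E : Type*} [Fintype E] [DecidableEq E] {A : ArithmeticMatroid E}

theorem isRepresentation_iff {G : Type*} [AddCommGroup G] {X : E → G} :
    A.IsRepresentation X ↔ (∀ I : Set E, A.matroid.Indep I ↔ LinearIndepOn ℤ X I) ∧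
      ∀ S : Finset E, A.mult S =
        (AddSubgroup.closure (X '' (S : Set E))).relIndex
          (isolatedHull (AddSubgroup.closure (X '' (S : Set E)))) := by
  unfold IsRepresentation RepresentsMatroid
  simp only [A.ground_eq, Set.subset_univ, true_imp_iff, linearIndepOn_mk_torsion_iff]

/-- Saturation is computed inside the image of `f` because that image is itself saturated. This
covers isomorphisms and the restriction to a saturated subgroup. -/
theorem isRepresentation_comp_iff {G G' : Type*} [AddCommGroup G] [AddCommGroup G'] {f : G →+ G'}
    (hf : Function.Injective f)
    (hsat : ∀ (y : G') (n : ℕ), 0 < n → n • y ∈ f.range → y ∈ f.range) {X : E → G} :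
    A.IsRepresentation (f ∘ X) ↔ A.IsRepresentation X := by
  rw [isRepresentation_iff, isRepresentation_iff]
  refine and_congr (forall_congr' fun I => iff_congr Iff.rfl ?_) (forall_congr' fun S => ?_)
  · exact LinearMap.linearIndepOn_iff_of_injOn f.toIntLinearMap hf.injOn
  · rw [Set.image_comp, ← AddMonoidHom.map_closure, ← map_isolatedHull hf hsat,
      AddSubgroup.relIndex_map_map_of_injective _ _ hf]

/-- The preimage in `G` of the group generated by the images of `S` is `⟨S ∪ Y⟩`. Preimages under a
surjection preserve saturation and relative index, and independence over the independent set `Y` is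
independence in the quotient. -/
theorem IsLifting.isRepresentation_mk {Y : Type*} [Fintype Y] [DecidableEq Y]
    {A' : ArithmeticMatroid (E ⊕ Y)} (h : A.IsLifting A')
    (hY : A'.matroid.Indep (Set.range Sum.inr)) {G : Type*} [AddCommGroup G] {X : E ⊕ Y → G}
    (hX : A'.IsRepresentation X) (N : AddSubgroup G)
    (hN : N = AddSubgroup.closure (X '' Set.range Sum.inr)) :
    A.IsRepresentation (fun e => (QuotientAddGroup.mk (X (Sum.inl e)) : G ⧸ N)) := by
  rw [isRepresentation_iff] at hX ⊢
  let π := QuotientAddGroup.mk' N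
  have hπ : Function.Surjective π := QuotientAddGroup.mk'_surjective N
  refine ⟨fun I => ?_, fun S => ?_⟩
  · have hd : Disjoint (Set.range Sum.inr : Set (E ⊕ Y)) (Sum.inl '' I) := by
      rw [Set.disjoint_left]
      rintro _ ⟨y, rfl⟩ ⟨e, -, he⟩
      cases he
    have hk : LinearMap.ker π.toIntLinearMap =
        Submodule.span ℤ (X '' Set.range Sum.inr) := by
      apply Submodule.toAddSubgroup_injective
      rw [Submodule.span_int_eq_addSubgroupClosure, ← hN]
      exact QuotientAddGroup.ker_mk' N
    rw [h.1, Matroid.comap_indep_iff, hY.contract_indep_iff, and_iff_right hd.symm,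
      and_iff_left Sum.inl_injective.injOn, hX.1, Set.union_comm,
      linearIndepOn_union_iff_of_ker_eq hd _ hk, and_iff_right ((hX.1 _).1 hY)]
    exact linearIndepOn_image_iff Sum.inl_injective (π ∘ X) I
  · rw [h.2, hX.2]
    have h1 : AddSubgroup.closure (X '' (S.disjSum Finset.univ : Finset (E ⊕ Y))) =
        (AddSubgroup.closure ((fun e => π (X (Sum.inl e))) '' S)).comap π := by
      have h2 : (fun e => π (X (Sum.inl e))) '' (S : Set E) = π '' ((X ∘ Sum.inl) '' S) := by
        rw [← Set.image_comp]; rfl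
      rw [h2, ← AddMonoidHom.map_closure, AddSubgroup.comap_map_eq, QuotientAddGroup.ker_mk', hN,
        ← AddSubgroup.closure_union]
      congr 1
      ext x
      simp [Finset.mem_disjSum]
    rw [h1, ← comap_isolatedHull, AddSubgroup.relIndex_comap,
      AddSubgroup.map_comap_eq_self_of_surjective hπ]
    rfl

end ArithmeticMatroid

/-! ### Lattice representations with a diagonal basis -/

theorem isMinorGcd_relIndex_image {ι σ F : Type*} [Fintype ι] [Fintype σ] (X : F → ι → ℤ)
    (g : σ → F) {S : Set F} (hS : Set.range g = S) :
    IsMinorGcd (Matrix.of fun i s => X (g s) i) ((AddSubgroup.closure (X '' S)).relIndex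
      (isolatedHull (AddSubgroup.closure (X '' S)))) := by
  have h : Set.range (Matrix.of fun i s => X (g s) i).col = X '' S := by
    rw [← hS, ← Set.range_comp]; rfl
  rw [← h]
  exact isMinorGcd_relIndex _

/-- Minors with two or more columns repeat a column and vanish, so the critical size is at most 1;
in size 0 the empty minor forces `m ∣ 1`. -/
theorem IsMinorGcd.dvd_of_unique {ι σ : Type*} [Subsingleton σ] {Z : Matrix ι σ ℤ} {m : ℕ}
    (h : IsMinorGcd Z m) (i : ι) (j : σ) : (m : ℤ) ∣ Z i j := by
  obtain ⟨r, -, h2, h3⟩ := h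
  obtain ⟨f, g, hfg⟩ := h3 2 Nat.prime_two
  match r with
  | 0 =>
    have := h2 f g
    rw [Matrix.det_fin_zero] at this
    exact this.trans (one_dvd _)
  | 1 => simpa using h2 (fun _ => i) (fun _ => j)
  | r + 2 =>
    refine absurd ?_ hfg
    rw [Matrix.det_zero_of_column_eq (i := 0) (j := 1) (by simp)
      (fun k => by simp [Subsingleton.elim (g 0) (g 1)])]
    exact dvd_zero _

theorem isMinorGcd_of_det_ne_zero {r : ℕ} (Q : Matrix (Fin r) (Fin r) ℤ) (hQ : Q.det ≠ 0) :
    IsMinorGcd Q Q.det.natAbs := by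
  simpa using isMinorGcd_mul_mul 1 Q 1 1 1 (one_mul 1) (one_mul 1) hQ

namespace ArithmeticMatroid

variable {F : Type*} [Fintype F] [DecidableEq F] {A : ArithmeticMatroid F}

theorem IsRepresentation.comp_equiv {G G' : Type*} [AddCommGroup G] [AddCommGroup G'] {X : F → G}
    (hX : A.IsRepresentation X) (f : G ≃+ G') : A.IsRepresentation (f ∘ X) :=
  (isRepresentation_comp_iff (f := f.toAddMonoidHom) f.injective
    (fun y _ _ _ => f.surjective y)).2 hX

/-- A represented torsion-free arithmetic matroid of rank `r` is represented in `ℤ ^ r`. -/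
theorem IsRepresentable.exists_lattice (hA : A.IsRepresentable) (ht : A.IsTorsionFree) {r : ℕ}
    {β : Fin r → F} (hβ : Function.Injective β) (hB : A.matroid.IsBase (Set.range β)) :
    ∃ X : F → Fin r → ℤ, A.IsRepresentation X := by
  obtain ⟨G, _, hfg, X, hX⟩ := hA
  have : Module.Finite ℤ G := Module.Finite.iff_addGroup_fg.2 hfg
  have hX' := isRepresentation_iff.1 hX
  -- The saturation of the zero group is the torsion subgroup, and its order is `m(∅) = 1`.
  have htf : isolatedHull (⊥ : AddSubgroup G) = ⊥ := by
    have h := hX'.2 ∅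
    rw [ht] at h
    simpa [AddSubgroup.relIndex_bot_left, eq_comm] using h
  let H := AddSubgroup.closure (Set.range (X ∘ β))
  -- The rank of `G` may exceed `r`; the saturation of the span of the basis has rank `r` and
  -- contains all the vectors.
  let N : Submodule ℤ G := (isolatedHull H).toIntSubmodule
  have hli : LinearIndependent ℤ (X ∘ β) := by
    have := (hX'.1 _).1 hB.indep
    rw [← Set.image_univ, linearIndepOn_image_iff hβ] at this
    exact linearIndepOn_univ_iff.1 this
  have hmem : ∀ e, X e ∈ N := by
    intro e
    by_cases he : e ∈ Set.range β
    · obtain ⟨i, rfl⟩ := he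
      exact closure_le_isolatedHull _ (AddSubgroup.subset_closure ⟨i, rfl⟩)
    · have hd : ¬ A.matroid.Indep (insert e (Set.range β)) := fun hI =>
        he (by rw [hB.eq_of_subset_indep hI (Set.subset_insert _ _)]; exact Set.mem_insert _ _)
      rw [hX'.1, ← Set.union_singleton, linearIndepOn_union_iff_quotient
        (Set.disjoint_singleton_right.2 he), and_iff_right ((hX'.1 _).1 hB.indep),
        LinearIndepOn, Fintype.not_linearIndependent_iff] at hd
      obtain ⟨g, hg, i, hi⟩ := hd
      rw [Fintype.sum_unique, Function.comp_apply, ← map_smul, Submodule.mkQ_apply,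
        Submodule.Quotient.mk_eq_zero, ← Submodule.mem_toAddSubgroup,
        Submodule.span_int_eq_addSubgroupClosure, ← Set.range_comp] at hg
      rw [Unique.eq_default i] at hi
      refine ⟨(g default).natAbs, Int.natAbs_pos.2 hi, ?_⟩
      rcases Int.natAbs_eq (g default) with h | h
      · rw [h, natCast_zsmul] at hg
        exact hg
      · rw [h, neg_smul, natCast_zsmul, AddSubgroup.neg_mem_iff] at hg
        exact hg
  have : Module.IsTorsionFree ℤ N := by
    rw [Module.isTorsionFree_int_iff_isAddTorsionFree]
    refine ⟨fun n hn a b hab => ?_⟩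
    have h0 : (a - b : G) ∈ isolatedHull (⊥ : AddSubgroup G) := by
      refine ⟨n, Nat.pos_of_ne_zero hn, ?_⟩
      have := congrArg Subtype.val hab
      simpa [smul_sub, sub_eq_zero] using this
    rw [htf] at h0
    exact Subtype.ext (sub_eq_zero.1 h0)
  have : Module.Free ℤ N := inferInstance
  let X' : F → N := fun e => ⟨X e, hmem e⟩
  have hli' : LinearIndependent ℤ (X' ∘ β) := LinearIndependent.of_comp N.subtype hli
  have hrank : Module.finrank ℤ N = r := by
    have h1 := Submodule.finrank_quotient_add_finrank (Submodule.span ℤ (Set.range (X' ∘ β)))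
    rw [finrank_span_eq_card hli', Fintype.card_fin] at h1
    rw [← h1, Module.finrank, rank_eq_zero_iff.2, map_zero, zero_add]
    intro q
    obtain ⟨⟨x, n, hn, hx⟩, rfl⟩ := Submodule.mkQ_surjective _ q
    refine ⟨n, by exact_mod_cast hn.ne', ?_⟩
    rw [← map_smul, Submodule.mkQ_apply, Submodule.Quotient.mk_eq_zero]
    have h2 : n • x ∈ (Submodule.span ℤ (Set.range (X' ∘ β))).map N.subtype := by
      rw [Submodule.map_span, ← Set.range_comp, ← Submodule.mem_toAddSubgroup,
        Submodule.span_int_eq_addSubgroupClosure]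
      exact hx
    obtain ⟨y, hy, hyx⟩ := h2
    have h3 : (n : ℤ) • (⟨x, n, hn, hx⟩ : N) = y := Subtype.ext (by simpa using hyx.symm)
    rw [h3]
    exact hy
  have hX1 : A.IsRepresentation X' := by
    refine (isRepresentation_comp_iff (f := N.subtype.toAddMonoidHom) N.injective_subtype ?_).1 hX
    rintro y n hn ⟨⟨z, k, hk, hz⟩, hzy⟩
    refine ⟨⟨y, k * n, Nat.mul_pos hk hn, ?_⟩, rfl⟩
    have h : z = n • y := hzy
    rwa [mul_smul, ← h]
  let φ : N ≃ₗ[ℤ] (Fin r → ℤ) := (Module.finBasisOfFinrankEq ℤ N hrank).equivFun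
  exact ⟨_, hX1.comp_equiv φ.toAddEquiv⟩

/-- The basis matrix is `M = P * diagonal m`, since `m({x})` divides the entries of column `x`. As
`|det M| = m(B) = ∏ m({x})`, `P` is unimodular, and applying its inverse makes the basis diagonal.
-/
theorem IsRepresentable.exists_diagonal (hA : A.IsRepresentable) (ht : A.IsTorsionFree) {r : ℕ}
    {β : Fin r → F} (hβ : Function.Injective β) (hB : A.matroid.IsBase (Set.range β))
    (hm : A.mult (Finset.univ.image β) = ∏ i, A.mult {β i}) :
    ∃ X : F → Fin r → ℤ, A.IsRepresentation X ∧
      ∀ i, X (β i) = Pi.single i (A.mult {β i} : ℤ) := by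
  obtain ⟨X, hX⟩ := hA.exists_lattice ht hβ hB
  have hX' := isRepresentation_iff.1 hX
  let M : Matrix (Fin r) (Fin r) ℤ := Matrix.of fun i j => X (β j) i
  have hdet : M.det ≠ 0 := by
    have := (hX'.1 _).1 hB.indep
    rw [← Set.image_univ, linearIndepOn_image_iff hβ] at this
    intro h0
    obtain ⟨v, hv, h0⟩ := Matrix.exists_mulVec_eq_zero_iff.2 h0
    exact hv (Matrix.mulVec_injective_iff.2 (linearIndepOn_univ_iff.1 this)
      (h0.trans (Matrix.mulVec_zero M).symm))
  have hM : M.det.natAbs = ∏ i, A.mult {β i} := by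
    rw [← hm, hX'.2]
    exact (isMinorGcd_of_det_ne_zero M hdet).unique
      (isMinorGcd_relIndex_image X β (by simp))
  have hdvd : ∀ i j, (A.mult {β j} : ℤ) ∣ M i j := by
    intro i j
    rw [hX'.2]
    exact (isMinorGcd_relIndex_image X (fun _ : Unit => β j) (by simp)).dvd_of_unique i ()
  choose p hp using hdvd
  let m : Fin r → ℤ := fun j => A.mult {β j}
  let P : Matrix (Fin r) (Fin r) ℤ := Matrix.of p
  have hPM : M = P * Matrix.diagonal m := by
    ext i j
    rw [Matrix.mul_diagonal, hp, mul_comm]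
    rfl
  have hP : IsUnit P.det := by
    rw [Int.isUnit_iff_natAbs_eq]
    rw [hPM, Matrix.det_mul, Matrix.det_diagonal, Int.natAbs_mul] at hM
    have h1 : (∏ i, m i).natAbs = ∏ i, A.mult {β i} := by
      rw [← Nat.cast_prod, Int.natAbs_natCast]
    rw [h1] at hM
    exact Nat.eq_of_mul_eq_mul_right (Finset.prod_pos fun i _ => A.mult_pos _)
      (by rw [hM, one_mul])
  let φ := P.toLinearEquiv' (P.invertibleOfIsUnitDet hP)
  refine ⟨_, hX.comp_equiv φ.symm.toAddEquiv, fun j => ?_⟩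
  show φ.symm (X (β j)) = _
  rw [LinearEquiv.symm_apply_eq]
  show X (β j) = P.mulVec _
  have : X (β j) = M.col j := rfl
  rw [this, hPM, ← Matrix.mulVec_single_one, ← Matrix.mulVec_mulVec]
  congr 1
  ext i
  by_cases h : i = j <;> simp [Matrix.mulVec_diagonal, m, h]

end ArithmeticMatroid

/-! ### Vanishing minors and the matroid -/

/-- For a list of vectors over a field in which a basis of the matroid is diagonal, the minors
that vanish are determined by the matroid. -/
theorem det_submatrix_ne_zero_iff {K F ι : Type*} [Field K] [Fintype ι] [DecidableEq ι]
    {M : Matroid F} {X : Matrix ι F K} (hX : ∀ I : Set F, M.Indep I ↔ LinearIndepOn K X.col I)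
    {β : ι → F} {c : ι → K} (hc : ∀ i, c i ≠ 0)
    (hβX : ∀ i, X.col (β i) = Pi.single i (c i)) {s : ℕ} (f : Fin s → ι) (g : Fin s → F) :
    (X.submatrix f g).det ≠ 0 ↔ Function.Injective f ∧ Function.Injective g ∧
      Disjoint (β '' (Set.range f)ᶜ) (Set.range g) ∧
        M.Indep (β '' (Set.range f)ᶜ ∪ Set.range g) := by
  by_cases hf : Function.Injective f
  swap
  · refine iff_of_false (not_not.2 ?_) fun h => hf h.1
    obtain ⟨i, j, hfij, hij⟩ := Function.not_injective_iff.1 hf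
    exact Matrix.det_zero_of_row_eq hij (by ext k; simp [hfij])
  by_cases hg : Function.Injective g
  swap
  · refine iff_of_false (not_not.2 ?_) fun h => hg h.2.1
    obtain ⟨i, j, hgij, hij⟩ := Function.not_injective_iff.1 hg
    exact Matrix.det_zero_of_column_eq hij (by simp [hgij])
  by_cases hd : Disjoint (β '' (Set.range f)ᶜ) (Set.range g)
  swap
  · refine iff_of_false (not_not.2 ?_) fun h => hd h.2.2.1
    obtain ⟨_, ⟨i, hi, rfl⟩, b, hb⟩ := Set.not_disjoint_iff.1 hd
    refine Matrix.det_eq_zero_of_column_eq_zero b fun a => ?_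
    have := congrFun (hβX i) (f a)
    rw [Matrix.submatrix_apply, hb]
    exact this.trans (Pi.single_eq_of_ne (fun h => hi ⟨a, h⟩) _)
  simp only [hf, hg, hd, true_and]
  -- Projection to the rows in `f` kills exactly the span of the basis vectors indexed outside `f`,
  -- so the minor tests independence of the columns in `g` modulo these vectors.
  let π : (ι → K) →ₗ[K] (Fin s → K) := LinearMap.funLeft K K f
  have hk : LinearMap.ker π = Submodule.span K (X.col '' (β '' (Set.range f)ᶜ)) := by
    apply le_antisymm
    · intro v hv
      have hv' : ∀ a, v (f a) = 0 := fun a => congrFun hv a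
      rw [pi_eq_sum_univ' v]
      refine Submodule.sum_mem _ fun i _ => ?_
      by_cases hi : i ∈ Set.range f
      · obtain ⟨a, rfl⟩ := hi
        rw [hv', zero_smul]
        exact Submodule.zero_mem _
      · have h1 : X.col (β i) ∈ Submodule.span K (X.col '' (β '' (Set.range f)ᶜ)) :=
          Submodule.subset_span ⟨_, ⟨i, hi, rfl⟩, rfl⟩
        convert Submodule.smul_mem _ (v i / c i) h1 using 1
        rw [hβX]
        ext k
        by_cases hki : k = i
        · subst hki; simp [hc]
        · simp [hki]
    · rw [Submodule.span_le]
      rintro _ ⟨_, ⟨i, hi, rfl⟩, rfl⟩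
      rw [hβX]
      ext a
      exact Pi.single_eq_of_ne (fun h => hi ⟨a, h⟩) _
  have hli : LinearIndepOn K X.col (β '' (Set.range f)ᶜ) := by
    have hβ : Function.Injective β := by
      intro i j hij
      by_contra hne
      have := (hβX i).symm.trans ((congrArg X.col hij).trans (hβX j))
      have := congrFun this i
      simp [hne, hc] at this
    rw [linearIndepOn_image_iff hβ]
    have h1 : X.col ∘ β = fun i => Pi.single i (c i) := funext hβX
    rw [h1]
    exact (Pi.linearIndependent_single_of_ne_zero (R := K) hc).linearIndepOn _
  rw [hX, linearIndepOn_union_iff_of_ker_eq hd π hk, and_iff_right hli, ← Set.image_univ,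
    linearIndepOn_image_iff hg, linearIndepOn_univ_iff]
  have h2 : (⇑π ∘ X.col) ∘ g = (X.submatrix f g).col := rfl
  rw [h2, Matrix.linearIndependent_cols_iff_isUnit, Matrix.isUnit_iff_isUnit_det, isUnit_iff_ne_zero]

/-- A representation of a matroid over a field can be chosen so that a given basis consists of
the standard unit vectors. -/
theorem RepresentsMatroid.exists_standard {K V F ι : Type*} [Field K] [AddCommGroup V] [Module K V]
    [Fintype ι] [DecidableEq ι] {M : Matroid F} {W : F → V} (hW : RepresentsMatroid K M W)
    (hE : M.E = Set.univ) {β : ι → F} (hβ : Function.Injective β)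
    (hB : M.IsBase (Set.range β)) :
    ∃ X : Matrix ι F K, (∀ I : Set F, M.Indep I ↔ LinearIndepOn K X.col I) ∧
      ∀ i, X.col (β i) = Pi.single i 1 := by
  have hW' : ∀ I : Set F, M.Indep I ↔ LinearIndepOn K W I := fun I => hW I (hE ▸ I.subset_univ)
  have hli := (hW' _).1 hB.indep
  have hspan : ∀ e, W e ∈ Submodule.span K (Set.range (W ∘ β)) := by
    intro e
    by_contra hne
    rw [Set.range_comp] at hne
    have he : e ∉ Set.range β := fun he => hne (Submodule.subset_span ⟨e, he, rfl⟩)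
    have hI := (hW' _).2 ((linearIndepOn_insert he).2 ⟨hli, hne⟩)
    exact he (by rw [hB.eq_of_subset_indep hI (Set.subset_insert _ _)]; exact Set.mem_insert _ _)
  rw [← Set.image_univ, linearIndepOn_image_iff hβ, linearIndepOn_univ_iff] at hli
  let T : (ι → K) →ₗ[K] V := Fintype.linearCombination K (W ∘ β)
  have hT : Function.Injective T := hli.fintypeLinearCombination_injective
  have hex : ∀ e, ∃ x, T x = W e := by
    intro e
    have := hspan e
    rwa [← Fintype.range_linearCombination] at this
  choose x hx using hex
  refine ⟨Matrix.of fun i e => x e i, fun I => ?_, fun i => hT ?_⟩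
  · rw [hW']
    have h1 : W = T ∘ (Matrix.of fun i e => x e i).col := funext fun e => (hx e).symm
    conv_lhs => rw [h1]
    exact LinearMap.linearIndepOn_iff_of_injOn T hT.injOn
  · refine (hx (β i)).trans ?_
    simp [T]

/-! ### Uniqueness of scaling for matrices with binary vanishing pattern -/

/-- Along a cycle in the bipartite graph of `X` whose matrix is singular modulo two, absolute
values that are scaled to one on all edges but two agree on these. -/
theorem abs_div_eq_of_cycle {ι F : Type*} {X : Matrix ι F ℚ} {Y : Matrix ι F (ZMod 2)}
    (hXY : ∀ (s : ℕ) (f : Fin s → ι) (g : Fin s → F),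
      (X.submatrix f g).det = 0 ↔ (Y.submatrix f g).det = 0)
    (hY : ∀ i j, X i j = 0 ↔ Y i j = 0)
    {t : ι → ℚ} {d : F → ℚ} (ht : ∀ i, 0 < t i) (hd : ∀ j, 0 < d j) {m : ℕ} (hm : 0 < m)
    (ρ : ℕ → ι) (γ : ℕ → F) (j : F)
    (hγ : ∀ k < m, ∀ a ≤ m, X (ρ a) (γ k) ≠ 0 ↔ a = k ∨ a = k + 1)
    (hj : ∀ a ≤ m, X (ρ a) j ≠ 0 ↔ a = 0 ∨ a = m)
    (h1 : ∀ k < m, |X (ρ k) (γ k)| = t (ρ k) * d (γ k))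
    (h2 : ∀ k < m, |X (ρ (k + 1)) (γ k)| = t (ρ (k + 1)) * d (γ k)) :
    |X (ρ 0) j| / t (ρ 0) = |X (ρ m) j| / t (ρ m) := by
  let f : Fin (m + 1) → ι := fun a => ρ a
  let g : Fin (m + 1) → F := fun b => if (b : ℕ) < m then γ b else j
  have hg1 : ∀ k (hk : k < m), g ⟨k, by omega⟩ = γ k := fun k hk => by simp [g, hk]
  have hg2 : g (Fin.last m) = j := by simp [g]
  have hz2 : ∀ x : ZMod 2, x ≠ 0 → x = 1 := by decide
  -- every column has exactly two nonzero entries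
  have htwo : ∀ b : Fin (m + 1), ∃ a a' : Fin (m + 1), a ≠ a' ∧
      ∀ c, X (f c) (g b) ≠ 0 ↔ c = a ∨ c = a' := by
    intro b
    by_cases hb : (b : ℕ) < m
    · refine ⟨⟨b, by omega⟩, ⟨b + 1, by omega⟩, by simp [Fin.ext_iff], fun c => ?_⟩
      rw [show g b = γ b from if_pos hb, Fin.ext_iff, Fin.ext_iff]
      exact hγ b hb c (by omega)
    · refine ⟨0, Fin.last m, by simp [Fin.ext_iff]; omega, fun c => ?_⟩
      rw [show g b = j from if_neg hb, Fin.ext_iff, Fin.ext_iff]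
      exact hj c (by omega)
  have hdet : (X.submatrix f g).det = 0 := by
    -- Over `ZMod 2` the rows add up to zero, as each column has exactly two ones.
    rw [hXY, ← Matrix.exists_vecMul_eq_zero_iff]
    refine ⟨fun _ => 1, fun h => one_ne_zero (congrFun h 0), ?_⟩
    ext b
    obtain ⟨a, a', hne, hc⟩ := htwo b
    have hc' : ∀ c, Y (f c) (g b) ≠ 0 ↔ c = a ∨ c = a' := fun c => by
      rw [← hc, Ne, Ne, hY]
    simp only [Matrix.vecMul, dotProduct, one_mul, Matrix.submatrix_apply, Pi.zero_apply]
    rw [Fintype.sum_eq_add a a' hne, hz2 _ ((hc' a).2 (Or.inl rfl)),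
      hz2 _ ((hc' a').2 (Or.inr rfl))]
    · decide
    · rintro x ⟨hx, hx'⟩
      by_contra h
      exact ((hc' x).1 h).elim hx hx'
  obtain ⟨y, hy0, hy⟩ := Matrix.exists_vecMul_eq_zero_iff.2 hdet
  have hcol : ∀ (b a a' : Fin (m + 1)), a ≠ a' →
      (∀ c, X (f c) (g b) ≠ 0 ↔ c = a ∨ c = a') →
      |y a| * |X (f a) (g b)| = |y a'| * |X (f a') (g b)| := by
    intro b a a' hne hc
    have h := congrFun hy b
    simp only [Matrix.vecMul, dotProduct, Matrix.submatrix_apply, Pi.zero_apply] at h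
    rw [Fintype.sum_eq_add a a' hne] at h
    · rw [← abs_mul, ← abs_mul, eq_neg_of_add_eq_zero_left h, abs_neg]
    · rintro x ⟨hx, hx'⟩
      by_contra h
      exact ((hc x).1 (right_ne_zero_of_mul h)).elim hx hx'
  -- Column `γ k` makes `|y| * t` agree at rows `ρ k` and `ρ (k + 1)`. It is thus constant along the
  -- path, and column `j` then compares the two ends.
  have hstep : ∀ k (hk : k < m), |y ⟨k, by omega⟩| * t (ρ k) =
      |y ⟨k + 1, by omega⟩| * t (ρ (k + 1)) := by
    intro k hk
    have h := hcol ⟨k, by omega⟩ ⟨k, by omega⟩ ⟨k + 1, by omega⟩ (by simp [Fin.ext_iff])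
      (fun c => by
        rw [hg1 k hk, Fin.ext_iff, Fin.ext_iff]
        exact hγ k hk c (by omega))
    rw [hg1 k hk] at h
    simp only [f] at h
    rw [h1 k hk, h2 k hk, ← mul_assoc, ← mul_assoc] at h
    exact mul_right_cancel₀ (hd _).ne' h
  have hall : ∀ k (hk : k ≤ m), |y ⟨k, by omega⟩| * t (ρ k) = |y 0| * t (ρ 0) := by
    intro k
    induction k with
    | zero => intro _; rfl
    | succ k ih => intro hk; rw [← hstep k (by omega), ih (by omega)]
  have hy00 : |y 0| ≠ 0 := by
    intro h0
    refine hy0 (funext fun a => ?_)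
    have h := hall a (by omega)
    rw [h0, zero_mul] at h
    simpa using (mul_eq_zero.1 h).resolve_right (ht _).ne'
  have hlast := hcol (Fin.last m) 0 (Fin.last m) (by simp [Fin.ext_iff]; omega) (fun c => by
    rw [hg2, Fin.ext_iff, Fin.ext_iff]
    exact hj c (by omega))
  have hm' := hall m le_rfl
  rw [hg2] at hlast
  simp only [f, Fin.val_zero, Fin.val_last] at hlast
  change |y (Fin.last m)| * t (ρ m) = _ at hm'
  rw [div_eq_div_iff (ht _).ne' (ht _).ne']
  apply mul_left_cancel₀ hy00
  linear_combination t (ρ m) * hlast + |X (ρ m) j| * hm'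

/-- A shortest walk has no shortcuts. -/
theorem SimpleGraph.Walk.le_succ_of_adj_getVert {V : Type*} {G : SimpleGraph V} {u v : V}
    (p : G.Walk u v) (hp : p.length = G.dist u v) {a b : ℕ} (hb : b ≤ p.length)
    (h : p.getVert a = p.getVert b ∨ G.Adj (p.getVert a) (p.getVert b)) : b ≤ a + 1 := by
  have h1 : G.dist u v ≤ a + 1 + (p.length - b) := by
    rcases h with h | h
    · refine (SimpleGraph.dist_le ((p.take a).append ((p.drop b).copy h.symm rfl))).trans ?_
      simp
    · refine (SimpleGraph.dist_le (((p.take a).concat h).append (p.drop b))).trans ?_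
      simp
  omega

/-- A rational matrix whose vanishing minors are those of a matrix over `ZMod 2` is, up to signs,
a diagonal scaling of its support matrix. -/
theorem exists_scaling {ι F : Type*} {X : Matrix ι F ℚ} {Y : Matrix ι F (ZMod 2)}
    (hXY : ∀ (s : ℕ) (f : Fin s → ι) (g : Fin s → F),
      (X.submatrix f g).det = 0 ↔ (Y.submatrix f g).det = 0) (S : Finset F) :
    ∃ (t : ι → ℚ) (d : F → ℚ), (∀ i, 0 < t i) ∧ (∀ j, 0 < d j) ∧
      ∀ j ∈ S, ∀ i, X i j ≠ 0 → |X i j| = t i * d j := by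
  classical
  have hY : ∀ i j, X i j = 0 ↔ Y i j = 0 := fun i j => by
    simpa using hXY 1 (fun _ => i) (fun _ => j)
  induction S using Finset.induction_on with
  | empty => exact ⟨fun _ => 1, fun _ => 1, by simp, by simp, by simp⟩
  | insert j S hjS ih =>
    obtain ⟨t, d, ht, hd, htd⟩ := ih
    -- Columns are added one at a time. Rows are adjacent when an earlier column meets both, so on
    -- each component `t` may still be rescaled by a common factor.
    let G : SimpleGraph ι := SimpleGraph.fromRel fun a b => ∃ s ∈ S, X a s ≠ 0 ∧ X b s ≠ 0
    have hG : ∀ {a b : ι} {s : F}, s ∈ S → X a s ≠ 0 → X b s ≠ 0 → a = b ∨ G.Adj a b := by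
      intro a b s hs ha hb
      by_cases hab : a = b
      · exact Or.inl hab
      · exact Or.inr ⟨hab, Or.inl ⟨s, hs, ha, hb⟩⟩
    have hG' : ∀ {a b : ι}, G.Adj a b → ∃ s ∈ S, X a s ≠ 0 ∧ X b s ≠ 0 := by
      rintro a b ⟨-, ⟨s, hs, h1, h2⟩ | ⟨s, hs, h1, h2⟩⟩
      exacts [⟨s, hs, h1, h2⟩, ⟨s, hs, h2, h1⟩]
    have hconst : ∀ n u v, G.Reachable u v → G.dist u v = n → X u j ≠ 0 → X v j ≠ 0 →
        |X u j| / t u = |X v j| / t v := by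
      intro n
      induction n using Nat.strong_induction_on with
      | _ n ihn =>
        intro u v huv hn hu hv
        obtain ⟨p, hp⟩ := huv.exists_walk_length_eq_dist
        have hpn : p.length = n := hp.trans hn
        rcases Nat.eq_zero_or_pos n with h0 | hpos
        · rw [p.eq_of_length_eq_zero (hpn.trans h0)]
        -- If column `j` meets the interior of the shortest path, split there and use induction.
        -- Otherwise the path closes up through `j` to a chordless cycle.
        by_cases hint : ∃ k, 0 < k ∧ k < n ∧ X (p.getVert k) j ≠ 0
        · obtain ⟨k, hk0, hkn, hk⟩ := hint
          have d1 : G.dist u (p.getVert k) ≤ k :=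
            (SimpleGraph.dist_le (p.take k)).trans (by simp)
          have d2 : G.dist (p.getVert k) v ≤ n - k :=
            (SimpleGraph.dist_le (p.drop k)).trans (by simp [hpn])
          exact (ihn _ (by omega) _ _ (p.take k).reachable rfl hu hk).trans
            (ihn _ (by omega) _ _ (p.drop k).reachable rfl hk hv)
        · push Not at hint
          have hcol : ∀ k, ∃ s, k < n → s ∈ S ∧ X (p.getVert k) s ≠ 0 ∧
              X (p.getVert (k + 1)) s ≠ 0 := by
            intro k
            by_cases hk : k < n
            · obtain ⟨s, hs, h⟩ := hG' (p.adj_getVert_succ (hpn ▸ hk))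
              exact ⟨s, fun _ => ⟨hs, h⟩⟩
            · exact ⟨j, fun h => absurd h hk⟩
          choose γ hγ using hcol
          have := abs_div_eq_of_cycle hXY hY ht hd hpos p.getVert γ j ?_ ?_
            (fun k hk => htd _ (hγ k hk).1 _ (hγ k hk).2.1)
            (fun k hk => htd _ (hγ k hk).1 _ (hγ k hk).2.2)
          · rwa [p.getVert_zero, ← hpn, p.getVert_length] at this
          · intro k hk a ha
            obtain ⟨hs, h1, h2⟩ := hγ k hk
            constructor
            · intro hXa
              by_contra hne
              push Not at hne
              rcases lt_or_gt_of_ne hne.1 with hlt | hgt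
              · have := p.le_succ_of_adj_getVert hp (a := a) (b := k + 1) (by omega)
                  (hG hs hXa h2)
                omega
              · have := p.le_succ_of_adj_getVert hp (a := k) (b := a) (by omega)
                  (hG hs h1 hXa)
                omega
            · rintro (rfl | rfl)
              exacts [h1, h2]
          · intro a ha
            constructor
            · intro hXa
              by_contra hne
              exact hXa (hint a (by omega) (by omega))
            · rintro (rfl | rfl)
              · simpa using hu
              · rw [← hpn, p.getVert_length]; exact hv
    -- The factor is the common value of `|X u j| / t u` on the component, or 1 if column `j` misses
    -- the component.
    let w : G.ConnectedComponent → ℚ := fun c =>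
      if h : ∃ u, G.connectedComponentMk u = c ∧ X u j ≠ 0 then |X h.choose j| / t h.choose else 1
    have hw : ∀ c, 0 < w c := by
      intro c
      by_cases h : ∃ u, G.connectedComponentMk u = c ∧ X u j ≠ 0
      · simp only [w, dif_pos h]
        exact div_pos (abs_pos.2 h.choose_spec.2) (ht _)
      · simp only [w, dif_neg h]
        exact one_pos
    have hwj : ∀ u, X u j ≠ 0 → w (G.connectedComponentMk u) = |X u j| / t u := by
      intro u hu
      have h : ∃ u', G.connectedComponentMk u' = G.connectedComponentMk u ∧ X u' j ≠ 0 :=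
        ⟨u, rfl, hu⟩
      simp only [w, dif_pos h]
      exact hconst _ _ _ (SimpleGraph.ConnectedComponent.exact h.choose_spec.1) rfl
        h.choose_spec.2 hu
    -- Column `j` is absorbed into the new row factors. The support of an earlier column lies in a
    -- single component, so dividing by that component's `w` compensates.
    let d' : F → ℚ := fun s => if s = j then 1 else
      if h : ∃ u, X u s ≠ 0 then d s / w (G.connectedComponentMk h.choose) else d s
    refine ⟨fun i => t i * w (G.connectedComponentMk i), d', fun i => mul_pos (ht i) (hw _),
      fun s => ?_, fun s hs i hi => ?_⟩
    · simp only [d']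
      split_ifs
      exacts [one_pos, div_pos (hd s) (hw _), hd s]
    · rcases eq_or_ne s j with rfl | hsj
      · simp only [d', if_true]
        rw [hwj i hi, mul_one, mul_div_cancel₀ _ (ht i).ne']
      · have hsS : s ∈ S := (Finset.mem_insert.1 hs).resolve_left hsj
        have h : ∃ u, X u s ≠ 0 := ⟨i, hi⟩
        have hcomp : G.connectedComponentMk h.choose = G.connectedComponentMk i := by
          rcases hG hsS h.choose_spec hi with he | ha
          · rw [he]
          · exact SimpleGraph.ConnectedComponent.sound ha.reachable
        simp only [d', if_neg hsj, dif_pos h]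
        rw [hcomp, htd s hsS i hi, mul_assoc, mul_div_cancel₀ _ (hw _).ne']

/-! ### Total unimodularity from even minors -/

theorem Matrix.det_eq_mul_det_schur {R : Type*} [CommRing R] {n : ℕ}
    (N : Matrix (Fin (n + 1)) (Fin (n + 1)) R) (c : R) (hc : c * N 0 0 = 1) :
    N.det = N 0 0 * (Matrix.of fun i j : Fin n =>
      N i.succ j.succ - N i.succ 0 * c * N 0 j.succ).det := by
  let N' : Matrix (Fin (n + 1)) (Fin (n + 1)) R :=
    Matrix.of fun i j => N i j - (if i = 0 then 0 else N i 0 * c) * N 0 j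
  have h0 : N.det = N'.det := by
    refine Matrix.det_eq_of_forall_row_eq_smul_add_const
      (fun i => if i = 0 then 0 else N i 0 * c) 0 (by simp) fun i j => ?_
    simp [N']
  rw [h0, Matrix.det_succ_column_zero, Fin.sum_univ_succ, Finset.sum_eq_zero]
  · simp only [Fin.val_zero, pow_zero, one_mul, add_zero]
    congr 1
    simp [N']
  · intro i _
    have : N' i.succ 0 = 0 := by
      simp only [N', Matrix.of_apply, Fin.succ_ne_zero, if_false]
      rw [mul_assoc, hc, mul_one, sub_self]
    rw [this]
    simp

/-- If the entries of an integer matrix are `0` and `±1` and all its even minors vanish, then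
its determinant is `0` or `±1`. -/
theorem Matrix.natAbs_det_le_one {n : ℕ} : ∀ N : Matrix (Fin n) (Fin n) ℤ,
    (∀ i j, (N i j).natAbs ≤ 1) →
    (∀ (s : ℕ) (f g : Fin s → Fin n), 2 ∣ (N.submatrix f g).det → (N.submatrix f g).det = 0) →
    N.det.natAbs ≤ 1 := by
  induction n with
  | zero => intro N _ _; simp
  | succ n ih =>
    have pivot : ∀ N : Matrix (Fin (n + 1)) (Fin (n + 1)) ℤ, (∀ i j, (N i j).natAbs ≤ 1) →
        (∀ (s : ℕ) (f g : Fin s → Fin (n + 1)),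
          2 ∣ (N.submatrix f g).det → (N.submatrix f g).det = 0) →
        N 0 0 ≠ 0 → N.det.natAbs ≤ 1 := by
      intro N h1 h2 h0
      have hc : N 0 0 * N 0 0 = 1 := by
        have := h1 0 0
        rcases (show N 0 0 = 1 ∨ N 0 0 = -1 by omega) with h | h <;> rw [h] <;> norm_num
      let N' : Matrix (Fin n) (Fin n) ℤ := Matrix.of fun i j =>
        N i.succ j.succ - N i.succ 0 * N 0 0 * N 0 j.succ
      -- Minors of the Schur complement are, up to the sign `N 0 0`, the minors of `N` bordered by
      -- row and column 0. So vanishing of even minors is inherited.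
      have hminor : ∀ (s : ℕ) (f g : Fin s → Fin n),
          (N.submatrix (Fin.cons 0 (Fin.succ ∘ f) : Fin (s + 1) → Fin (n + 1))
            (Fin.cons 0 (Fin.succ ∘ g) : Fin (s + 1) → Fin (n + 1))).det =
            N 0 0 * (N'.submatrix f g).det := by
        intro s f g
        rw [Matrix.det_eq_mul_det_schur _ (N 0 0) (by simpa using hc)]
        simp only [Matrix.submatrix_apply, Fin.cons_zero, Fin.cons_succ]
        rfl
      have h2' : ∀ (s : ℕ) (f g : Fin s → Fin n),
          2 ∣ (N'.submatrix f g).det → (N'.submatrix f g).det = 0 := by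
        intro s f g hd
        have := h2 _ _ _ (by rw [hminor s f g]; exact Dvd.dvd.mul_left hd _)
        rw [hminor] at this
        exact (mul_eq_zero.1 this).resolve_left h0
      -- An entry is a difference of two numbers in `{-1, 0, 1}`. The only bad values, `±2`, would
      -- be nonzero even minors of size 1.
      have h1' : ∀ i j, (N' i j).natAbs ≤ 1 := by
        intro i j
        have ha := h1 i.succ j.succ
        have hb : (N i.succ 0 * N 0 0 * N 0 j.succ).natAbs ≤ 1 := by
          rw [Int.natAbs_mul, Int.natAbs_mul]
          exact mul_le_one' (mul_le_one' (h1 _ _) (h1 _ _)) (h1 _ _)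
        have he := h2' 1 (fun _ => i) (fun _ => j)
        rw [Matrix.det_fin_one] at he
        simp only [Matrix.submatrix_apply, N', Matrix.of_apply] at he ⊢
        omega
      rw [Matrix.det_eq_mul_det_schur N (N 0 0) hc, Int.natAbs_mul]
      exact mul_le_one' (h1 0 0) (ih N' h1' h2')
    intro N h1 h2
    by_cases hz : ∀ i, N i 0 = 0
    · rw [Matrix.det_eq_zero_of_column_eq_zero 0 hz]; simp
    · push Not at hz
      obtain ⟨a, ha⟩ := hz
      have h3 := pivot (N.submatrix (Equiv.swap 0 a) id) (fun i j => h1 _ _)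
        (fun s f g => h2 s _ _) (by simpa using ha)
      rw [Matrix.det_permute, Int.natAbs_mul] at h3
      rcases Int.units_eq_one_or (Equiv.Perm.sign (Equiv.swap 0 a)) with h | h <;>
        simpa [h] using h3

theorem Matrix.isTotallyUnimodular_of_even_minors {ι F : Type*} {U : Matrix ι F ℤ}
    (h1 : ∀ i j, (U i j).natAbs ≤ 1)
    (h2 : ∀ (s : ℕ) (f : Fin s → ι) (g : Fin s → F),
      2 ∣ (U.submatrix f g).det → (U.submatrix f g).det = 0) : U.IsTotallyUnimodular := by
  intro s f g _ _
  have h := Matrix.natAbs_det_le_one (U.submatrix f g) (fun i j => h1 _ _)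
    (fun s' f' g' => h2 s' (f ∘ f') (g ∘ g'))
  rcases (show (U.submatrix f g).det = 0 ∨ (U.submatrix f g).det = 1 ∨
    (U.submatrix f g).det = -1 by omega) with h | h | h
  · exact ⟨0, by simp [h]⟩
  · exact ⟨1, by simp [h]⟩
  · exact ⟨-1, by simp [h]⟩

/-! ### Diagonal scaling and powers -/

theorem Matrix.linearIndepOn_int_col_iff {ι F : Type*} (Z : Matrix ι F ℤ) (I : Set F) :
    LinearIndepOn ℤ Z.col I ↔ LinearIndepOn ℚ (Z.map (Int.cast : ℤ → ℚ)).col I := by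
  let φ : (ι → ℤ) →ₗ[ℤ] (ι → ℚ) := (Int.castAddHom ℚ).toIntLinearMap.compLeft ι
  have hφ : Function.Injective φ := fun v w h => funext fun i =>
    Int.cast_injective (congrFun h i)
  rw [← LinearMap.linearIndepOn_iff_of_injOn φ hφ.injOn, LinearIndepOn,
    LinearIndependent.iff_fractionRing ℤ ℚ]
  rfl

theorem linearIndepOn_col_iff_of_scaling {ι F : Type*} {Z U : Matrix ι F ℤ}
    {T : ι → ℚ} {D : F → ℚ} (hT : ∀ i, T i ≠ 0) (hD : ∀ j, D j ≠ 0)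
    (h : ∀ i j, (Z i j : ℚ) = T i * U i j * D j) (I : Set F) :
    LinearIndepOn ℤ Z.col I ↔ LinearIndepOn ℤ U.col I := by
  rw [Matrix.linearIndepOn_int_col_iff, Matrix.linearIndepOn_int_col_iff]
  let φ : (ι → ℚ) →ₗ[ℚ] (ι → ℚ) := LinearMap.pi fun i => T i • LinearMap.proj i
  have hφ : Function.Injective φ := fun v w h => funext fun i =>
    mul_left_cancel₀ (hT i) (congrFun h i)
  have hZ : (Z.map (Int.cast : ℤ → ℚ)).col =
      (fun j => Units.mk0 (D j) (hD j)) • (φ ∘ (U.map (Int.cast : ℤ → ℚ)).col) := by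
    ext j i
    simp [φ, h, mul_comm, Units.smul_def]
  rw [hZ]
  exact (LinearIndependent.units_smul_iff (fun j : I => φ ((U.map (Int.cast : ℤ → ℚ)).col j))
    (fun j : I => Units.mk0 (D j) (hD j))).trans
    (LinearMap.linearIndepOn_iff_of_injOn φ hφ.injOn)

theorem det_submatrix_of_scaling {ι F : Type*} {Z U : Matrix ι F ℤ} {T : ι → ℚ} {D : F → ℚ}
    (h : ∀ i j, (Z i j : ℚ) = T i * U i j * D j) {s : ℕ} (f : Fin s → ι) (g : Fin s → F) :
    ((Z.submatrix f g).det : ℚ) =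
      (∏ a, T (f a)) * (U.submatrix f g).det * ∏ a, D (g a) := by
  have h1 : (Z.submatrix f g).map (Int.cast : ℤ → ℚ) = Matrix.diagonal (fun a => T (f a)) *
      (U.submatrix f g).map (Int.cast : ℤ → ℚ) * Matrix.diagonal (fun a => D (g a)) := by
    ext a b
    simp [h]
  rw [Int.cast_det, h1, Matrix.det_mul, Matrix.det_mul, Matrix.det_diagonal, Matrix.det_diagonal,
    Int.cast_det]

/-- A minor of `U` is 0 or `±1`, so the two minors are governed by the same product of diagonal
entries. Vanishing is stated separately because `0 ^ k = 1` for `k = 0`. -/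
theorem natAbs_det_of_scaling_pow {ι F : Type*} {X Z U : Matrix ι F ℤ} {t : ι → ℚ} {d : F → ℚ}
    (ht : ∀ i, 0 < t i) (hd : ∀ j, 0 < d j) {k : ℕ}
    (hX : ∀ i j, (X i j : ℚ) = t i * U i j * d j)
    (hZ : ∀ i j, (Z i j : ℚ) = t i ^ k * U i j * d j ^ k) (hU : U.IsTotallyUnimodular)
    (s : ℕ) (f : Fin s → ι) (g : Fin s → F) :
    ((X.submatrix f g).det = 0 → (Z.submatrix f g).det = 0) ∧
      ((X.submatrix f g).det ≠ 0 →
        (Z.submatrix f g).det.natAbs = (X.submatrix f g).det.natAbs ^ k) := by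
  have h1 := det_submatrix_of_scaling hX f g
  have h2 := det_submatrix_of_scaling (T := fun i => t i ^ k) (D := fun j => d j ^ k) hZ f g
  have pt : 0 < ∏ a, t (f a) := Finset.prod_pos fun a _ => ht _
  have pd : 0 < ∏ a, d (g a) := Finset.prod_pos fun a _ => hd _
  rw [Finset.prod_pow, Finset.prod_pow] at h2
  constructor
  · intro h0
    rw [h0, Int.cast_zero, eq_comm, mul_eq_zero, mul_eq_zero] at h1
    have hu : ((U.submatrix f g).det : ℚ) = 0 := by
      rcases h1 with (h | h) | h
      exacts [absurd h pt.ne', h, absurd h pd.ne']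
    rw [hu, mul_zero, zero_mul] at h2
    exact_mod_cast h2
  · intro h0
    have hu : |((U.submatrix f g).det : ℚ)| = 1 := by
      obtain ⟨σ, hσ⟩ := (Matrix.isTotallyUnimodular_iff U).1 hU s f g
      rw [← hσ]
      cases σ with
      | zero =>
        refine absurd ?_ h0
        have hz : (U.submatrix f g).det = 0 := by rw [← hσ]; rfl
        rw [hz, Int.cast_zero, mul_zero, zero_mul] at h1
        exact_mod_cast h1
      | pos => simp
      | neg => simp
    have e1 : ((X.submatrix f g).det.natAbs : ℚ) = (∏ a, t (f a)) * ∏ a, d (g a) := by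
      rw [Nat.cast_natAbs, Int.cast_abs, h1, abs_mul, abs_mul, hu, abs_of_pos pt, abs_of_pos pd,
        mul_one]
    have e2 : ((Z.submatrix f g).det.natAbs : ℚ) = (∏ a, t (f a)) ^ k * (∏ a, d (g a)) ^ k := by
      rw [Nat.cast_natAbs, Int.cast_abs, h2, abs_mul, abs_mul, hu, abs_of_pos (pow_pos pt k),
        abs_of_pos (pow_pos pd k), mul_one]
    have : ((Z.submatrix f g).det.natAbs : ℚ) = ((X.submatrix f g).det.natAbs ^ k : ℕ) := by
      rw [e2, Nat.cast_pow, e1, mul_pow]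
    exact_mod_cast this

/-! ### The factorization and the main theorem -/

namespace ArithmeticMatroid

variable {F : Type*} [Fintype F] [DecidableEq F] {A : ArithmeticMatroid F}

/-- If `X = T U D` with `U` totally unimodular represents `A`, then `T ^ k U D ^ k`
represents `A ^ k`. -/
theorem IsRepresentation.power {ι : Type*} [Fintype ι] {X Z U : Matrix ι F ℤ}
    {t : ι → ℚ} {d : F → ℚ} (ht : ∀ i, 0 < t i) (hd : ∀ j, 0 < d j) {k : ℕ}
    (hX : ∀ i j, (X i j : ℚ) = t i * U i j * d j)
    (hZ : ∀ i j, (Z i j : ℚ) = t i ^ k * U i j * d j ^ k) (hU : U.IsTotallyUnimodular)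
    (h : A.IsRepresentation X.col) : (A.power k).IsRepresentation Z.col := by
  rw [isRepresentation_iff] at h ⊢
  refine ⟨fun I => ?_, fun S => ?_⟩
  · rw [linearIndepOn_col_iff_of_scaling (fun i => (pow_pos (ht i) k).ne')
      (fun j => (pow_pos (hd j) k).ne') hZ,
      ← linearIndepOn_col_iff_of_scaling (fun i => (ht i).ne') (fun j => (hd j).ne') hX]
    exact h.1 I
  · have h1 := isMinorGcd_relIndex_image X.col (Subtype.val : S → F) (S := S) (by simp)
    have h2 := isMinorGcd_relIndex_image Z.col (Subtype.val : S → F) (S := S) (by simp)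
    rw [← h.2 S] at h1
    exact (h1.pow (k := k) fun s f g =>
      natAbs_det_of_scaling_pow ht hd hX hZ hU s f (Subtype.val ∘ g)).unique h2

theorem IsRepresentable.exists_diagonal_of_fintype {ι : Type*} [Fintype ι] [DecidableEq ι]
    (hA : A.IsRepresentable) (ht : A.IsTorsionFree)
    {β : ι → F} (hβ : Function.Injective β) (hB : A.matroid.IsBase (Set.range β))
    (hm : A.mult (Finset.univ.image β) = ∏ i, A.mult {β i}) :
    ∃ X : Matrix ι F ℤ, A.IsRepresentation X.col ∧
      ∀ i, X.col (β i) = Pi.single i (A.mult {β i} : ℤ) := by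
  let e := Fintype.equivFin ι
  obtain ⟨X, hX, hXβ⟩ := hA.exists_diagonal ht (β := β ∘ e.symm) (hβ.comp e.symm.injective)
    (by rwa [e.symm.surjective.range_comp])
    (by
      rw [← Finset.image_image, Finset.image_univ_of_surjective e.symm.surjective, hm]
      exact (e.symm.prod_comp fun i => A.mult {β i}).symm)
  refine ⟨Matrix.of fun i j => X j (e i),
    hX.comp_equiv (LinearEquiv.funCongrLeft ℤ ℤ e).toAddEquiv, fun i => ?_⟩
  ext i'
  have := congrFun (hXβ (e i)) (e i')
  simp only [Function.comp_apply, Equiv.symm_apply_apply] at this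
  refine this.trans ?_
  by_cases h : i' = i
  · subst h; simp
  · rw [Pi.single_eq_of_ne h, Pi.single_eq_of_ne (e.injective.ne h)]

/-- A representable torsion-free arithmetic matroid with a multiplicative basis, whose matroid is
regular, is represented by `T U D` with `U` totally unimodular and `T`, `D` diagonal, and its
powers are represented by `T ^ k U D ^ k`. -/
theorem exists_isTotallyUnimodular_scaling {ι : Type*} [Fintype ι] [DecidableEq ι]
    (hA : A.IsRepresentable) (ht : A.IsTorsionFree) (hreg : IsRegularMatroid A.matroid)
    {β : ι → F} (hβ : Function.Injective β) (hB : A.matroid.IsBase (Set.range β))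
    (hm : A.mult (Finset.univ.image β) = ∏ i, A.mult {β i}) :
    ∃ (U : Matrix ι F ℤ) (T : ι → ℚ) (D : F → ℚ), U.IsTotallyUnimodular ∧
      U.submatrix id β = 1 ∧ (∀ i, T i ≠ 0) ∧ (∀ j, D j ≠ 0) ∧
      ∀ k : ℕ, ∃ Z : Matrix ι F ℤ,
        (∀ i j, (Z i j : ℚ) = T i ^ k * U i j * D j ^ k) ∧
        (A.power k).IsRepresentation Z.col := by
  obtain ⟨X, hX, hXβ⟩ := hA.exists_diagonal_of_fintype ht hβ hB hm
  -- Regularity enters only through the field with two elements.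
  obtain ⟨V, W, hW⟩ := hreg (ZMod 2)
  obtain ⟨Y, hY, hYβ⟩ := hW.exists_standard A.ground_eq hβ hB
  have hmpos : ∀ i, (0 : ℤ) < A.mult {β i} := fun i => by exact_mod_cast A.mult_pos _
  have hXQ : ∀ (s : ℕ) (f : Fin s → ι) (g : Fin s → F),
      ((X.map (Int.cast : ℤ → ℚ)).submatrix f g).det = 0 ↔ (Y.submatrix f g).det = 0 := by
    intro s f g
    rw [← not_iff_not, ← Ne, ← Ne,
      det_submatrix_ne_zero_iff (M := A.matroid) (β := β) (c := fun i => ((A.mult {β i} : ℤ) : ℚ)),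
      det_submatrix_ne_zero_iff hY (fun _ => one_ne_zero) hYβ]
    · intro I
      rw [← Matrix.linearIndepOn_int_col_iff]
      exact (isRepresentation_iff.1 hX).1 I
    · intro i
      exact_mod_cast (hmpos i).ne'
    · intro i
      ext i'
      have h1 : (X.map (Int.cast : ℤ → ℚ)).col (β i) i' = ((X.col (β i) i' : ℤ) : ℚ) := rfl
      rw [h1, hXβ]
      by_cases h : i' = i
      · subst h; simp
      · simp [h]
  obtain ⟨t, d, htpos, hdpos, htd⟩ := exists_scaling hXQ Finset.univ
  let U : Matrix ι F ℤ := Matrix.of fun i j => (X i j).sign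
  have htd' : ∀ i j, X i j ≠ 0 → |(X i j : ℚ)| = t i * d j := fun i j h =>
    htd j (Finset.mem_univ _) i (by simpa using h)
  have hXU : ∀ i j, (X i j : ℚ) = t i * U i j * d j := by
    intro i j
    by_cases h : X i j = 0
    · simp [U, h]
    · have h1 : X i j = (X i j).sign * |X i j| := (Int.sign_mul_abs _).symm
      have h2 : (X i j : ℚ) = (X i j).sign * |(X i j : ℚ)| := by exact_mod_cast h1
      rw [h2, htd' i j h]
      simp only [U, Matrix.of_apply]
      ring
  have hUY : ∀ i j, ((U i j : ℤ) : ZMod 2) = Y i j := by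
    intro i j
    have h1 : X i j = 0 ↔ Y i j = 0 := by
      simpa using hXQ 1 (fun _ => i) (fun _ => j)
    have hz2 : ∀ x : ZMod 2, x ≠ 0 → x = 1 := by decide
    rcases lt_trichotomy (X i j) 0 with h | h | h
    · rw [hz2 _ fun h0 => h.ne (h1.2 h0)]
      simp only [U, Matrix.of_apply, Int.sign_eq_neg_one_of_neg h]
      decide
    · rw [h1.1 h]
      simp [U, h]
    · rw [hz2 _ fun h0 => h.ne' (h1.2 h0)]
      simp [U, Int.sign_eq_one_of_pos h]
  have hTU : U.IsTotallyUnimodular := by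
    refine Matrix.isTotallyUnimodular_of_even_minors (fun i j => ?_) fun s f g h2 => ?_
    · simp only [U, Matrix.of_apply, Int.natAbs_sign]
      split_ifs <;> simp
    · have h3 : (Y.submatrix f g).det = 0 := by
        have h4 : Y.submatrix f g = (U.submatrix f g).map (Int.cast : ℤ → ZMod 2) := by
          ext a b
          exact (hUY _ _).symm
        rw [h4, ← Int.cast_det]
        exact (ZMod.intCast_zmod_eq_zero_iff_dvd _ 2).2 h2
      -- An even minor of `U` vanishes in `Y`, hence in `X`, hence in `U`, since the scaling factors
      -- are nonzero.
      rw [← hXQ, Matrix.submatrix_map, ← Int.cast_det, det_submatrix_of_scaling hXU, mul_eq_zero,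
        mul_eq_zero] at h3
      rcases h3 with (h | h) | h
      · exact absurd h (Finset.prod_pos fun a _ => htpos _).ne'
      · exact_mod_cast h
      · exact absurd h (Finset.prod_pos fun a _ => hdpos _).ne'
  refine ⟨U, t, d, hTU, ?_, fun i => (htpos i).ne', fun j => (hdpos j).ne', fun k => ?_⟩
  · ext i i'
    have h1 : X i (β i') = (Pi.single i' (A.mult {β i'} : ℤ) : ι → ℤ) i := congrFun (hXβ i') i
    simp only [U, Matrix.submatrix_apply, Matrix.of_apply, id, h1]
    by_cases h : i = i'
    · subst h
      rw [Pi.single_eq_same, Matrix.one_apply_eq, Int.sign_eq_one_of_pos (hmpos i)]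
    · rw [Pi.single_eq_of_ne h, Matrix.one_apply_ne h, Int.sign_zero]
  -- On the support of `X`, `t i ^ k * d j ^ k = |X i j| ^ k`. Hence the scaled matrix is integral
  -- although `t` and `d` are only rational.
  · have hZ : ∀ i j, (((Matrix.of fun i j => U i j * |X i j| ^ k : Matrix ι F ℤ) i j : ℤ) : ℚ) =
        t i ^ k * U i j * d j ^ k := by
      intro i j
      by_cases h : X i j = 0
      · simp [U, h]
      · simp only [Matrix.of_apply, Int.cast_mul, Int.cast_pow, Int.cast_abs]
        rw [htd' i j h]
        ring
    exact ⟨_, hZ, hX.power htpos hdpos hXU hZ hTU⟩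

theorem IsLifting.power {E Y : Type*} [Fintype E] [DecidableEq E] [Fintype Y] [DecidableEq Y]
    {A : ArithmeticMatroid E} {A' : ArithmeticMatroid (E ⊕ Y)} (h : A.IsLifting A') (k : ℕ) :
    (A.power k).IsLifting (A'.power k) :=
  ⟨h.1, fun S => congrArg (· ^ k) (h.2 S)⟩

end ArithmeticMatroid

theorem mainTheorem4 {E : Type*} [Fintype E] [DecidableEq E] (A : ArithmeticMatroid E)
    (hA : A.IsRegularWeaklyMultiplicative) :
    (∀ k : ℕ, (A.power k).IsRepresentable) ∧
    ∃ (d n : ℕ) (b : Fin d → E)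
      (U : Matrix (Fin d ⊕ Fin n) (E ⊕ Fin n) ℤ)
      (T : Fin d ⊕ Fin n → ℚ) (D : E ⊕ Fin n → ℚ),
      U.IsTotallyUnimodular ∧
      U.submatrix id (Sum.map b id) = (1 : Matrix (Fin d ⊕ Fin n) (Fin d ⊕ Fin n) ℤ) ∧
      (∀ i, T i ≠ 0) ∧ (∀ j, D j ≠ 0) ∧
      ∀ k : ℕ, ∃ Z : Matrix (Fin d ⊕ Fin n) (E ⊕ Fin n) ℤ,
        Z.map (Int.cast : ℤ → ℚ) =
          Matrix.diagonal T ^ k * U.map (Int.cast : ℤ → ℚ) * Matrix.diagonal D ^ k ∧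
        (A.power k).IsRepresentation (quotientList Z) := by
  suffices h : ∃ (d n : ℕ) (b : Fin d → E)
      (U : Matrix (Fin d ⊕ Fin n) (E ⊕ Fin n) ℤ)
      (T : Fin d ⊕ Fin n → ℚ) (D : E ⊕ Fin n → ℚ),
      U.IsTotallyUnimodular ∧
      U.submatrix id (Sum.map b id) = (1 : Matrix (Fin d ⊕ Fin n) (Fin d ⊕ Fin n) ℤ) ∧
      (∀ i, T i ≠ 0) ∧ (∀ j, D j ≠ 0) ∧
      ∀ k : ℕ, ∃ Z : Matrix (Fin d ⊕ Fin n) (E ⊕ Fin n) ℤ,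
        Z.map (Int.cast : ℤ → ℚ) =
          Matrix.diagonal T ^ k * U.map (Int.cast : ℤ → ℚ) * Matrix.diagonal D ^ k ∧
        (A.power k).IsRepresentation (quotientList Z) by
    refine ⟨fun k => ?_, h⟩
    obtain ⟨d, n, b, U, T, D, -, -, -, -, h⟩ := h
    obtain ⟨Z, -, hZ⟩ := h k
    have : AddGroup.FG (Fin d ⊕ Fin n → ℤ) := Module.Finite.iff_addGroup_fg.1 inferInstance
    exact ⟨_, inferInstance, inferInstance, _, hZ⟩
  obtain ⟨Y, _, _, A', hlift, htf, hrep, hreg, B, ⟨hB, hBm⟩, hYB⟩ := hA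
  let σ := (Fintype.equivFin Y).symm
  let BE : Finset E := Finset.univ.filter fun e => Sum.inl e ∈ B
  let b : Fin BE.card → E := fun i => BE.equivFin.symm i
  -- As `Y ⊆ B`, the basis splits into its part in `E` and all of `Y`; this gives the row index set
  -- and the identity block of `U`.
  let β : Fin BE.card ⊕ Fin (Fintype.card Y) → E ⊕ Y := Sum.map b σ
  have hb : Function.Injective b := Subtype.val_injective.comp BE.equivFin.symm.injective
  have hβ : Function.Injective β := hb.sumMap σ.injective
  have hBβ : Finset.univ.image β = B := by
    ext x
    rw [Finset.mem_image]
    constructor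
    · rintro ⟨i | i, -, rfl⟩
      · exact (Finset.mem_filter.1 (BE.equivFin.symm i).2).2
      · exact hYB _
    · intro hx
      rcases x with e | y
      · have he : e ∈ BE := Finset.mem_filter.2 ⟨Finset.mem_univ _, hx⟩
        exact ⟨Sum.inl (BE.equivFin ⟨e, he⟩), Finset.mem_univ _, by simp [β, b]⟩
      · exact ⟨Sum.inr (σ.symm y), Finset.mem_univ _, by simp [β]⟩
  have hrange : Set.range β = B := by rw [← hBβ]; simp
  obtain ⟨U, T, D, hU, hU1, hT, hD, hZ⟩ :=
    ArithmeticMatroid.exists_isTotallyUnimodular_scaling hrep htf hreg hβ (hrange ▸ hB)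
      (by rw [hBβ, hBm, ← hBβ, Finset.prod_image hβ.injOn])
  refine ⟨BE.card, Fintype.card Y, b, U.submatrix id (Sum.map id σ), T, D ∘ Sum.map id σ,
    hU.submatrix _ _, ?_, hT, fun j => hD _, fun k => ?_⟩
  · rw [← hU1]
    ext i (j | j) <;> rfl
  · obtain ⟨Z, hZ, hrepZ⟩ := hZ k
    refine ⟨Z.submatrix id (Sum.map id σ), ?_, ?_⟩
    · ext i j
      simp [Matrix.diagonal_pow, hZ]
    · refine (hlift.power k).isRepresentation_mk
        (hB.indep.subset ?_) hrepZ (AddSubgroup.closure _) ?_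
      · rintro _ ⟨y, rfl⟩
        exact hYB y
      · congr 1
        rw [← Set.range_comp, ← σ.surjective.range_comp]
        rfl
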